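/- Let $W,V\in\mathbb C[z]$ with $m=\deg W\ge 2$, $\deg V<\deg W$, $W$ having $m$ distinct zeros $z_1,\dots,z_m$, $W(0)=0$, and $2V(z_j)/W'(z_j)\notin\mathbb Z_{\ge 0}$ for all $j$. Let $w$ be a regular semi-classical weight on the unit circle $\mathbb T$: $w$ is single-valued and continuous on $\mathbb T$, it is differentiable along $\mathbb T$ away from the zeros of $W$ with $W(z)w'(z)=2V(z)w(z)$ there, and $w'\in L^1(\mathbb T)$. Let $\{\phi_n,\bar\phi_n\}_{n\ge0}$ be bi-orthonormal polynomials of degree $n$ with equal leading coefficients $\kappa_n$, $$\int_{\mathbb T}\frac{d\zeta}{2\pi i\zeta}\,w(\zeta)\phi_m(\zeta)\bar\phi_n(\bar\zeta)=\delta_{m,n},$$ where $\bar\phi_n$ need not be the complex conjugate of $\phi_n$. Put $\phi_n^*(z)=z^n\bar\phi_n(1/z)$, $F(z)=\int_{\mathbb T}\frac{d\zeta}{2\pi i\zeta}\frac{\zeta+z}{\zeta-z}w(\zeta)$, $\psi_0=\psi_0^*=1/\kappa_0$ and, for $n\ge1$, $$\psi_n(z)=\int_{\mathbb T}\frac{d\zeta}{2\pi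 i\zeta}\frac{\zeta+z}{\zeta-z}w(\zeta)[\phi_n(\zeta)-\phi_n(z)],\qquad \psi^*_n(z)=-\int_{\mathbb T}\frac{d\zeta}{2\pi i\zeta}\frac{\zeta+z}{\zeta-z}w(\zeta)[z^n\bar\phi_n(\bar\zeta)-\phi_n^*(z)],$$ and set $\epsilon_n=\psi_n+F\phi_n$, $\epsilon_n^*=\psi_n^*-F\phi_n^*$ for $|z|\neq1$. If $\phi_{n+1}(0)\ne0$, there are unique polynomials $\Theta_n,\Omega_n$ with $$W\phi_n'=\Theta_n\phi_{n+1}-(\Omega_n+V)\phi_n,\qquad W\epsilon_n'=\Theta_n\epsilon_{n+1}-(\Omega_n-V)\epsilon_n\quad(|z|\ne1),$$ and if $\bar\phi_{n+1}(0)\neq0$, there are unique polynomials $\Theta^*_n,\Omega^*_n$ with $$W\phi_n^{*\prime}=-\Theta^*_n\phi^*_{n+1}+(\Omega^*_n-V)\phi^*_n,\qquad W\epsilon_n^{*\prime}=-\Theta^*_n\epsilon^*_{n+1}+(\Omega^*_n+V)\epsilon^*_n\quad(|z|\ne1).$$ At every zero $z_j\ne0$ of $W$ these coefficient functions satisfy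 the following bilinear identities, for $n\ge 0$ in (a), (b), (e), (f) and $n\ge1$ in (c), (d), each whenever the values $\phi_k(0)$, $\bar\phi_k(0)$ that occur in its denominators, or whose non-vanishing is needed to define the coefficient functions in it, are nonzero: $$\text{(a)}\quad \Omega_n(z_j)^2=\frac{\kappa_n\phi_{n+2}(0)}{\kappa_{n+1}\phi_{n+1}(0)}z_j\Theta_n(z_j)\Theta_{n+1}(z_j)+V(z_j)^2,$$ $$\text{(b)}\quad \Omega^*_n(z_j)^2=\frac{\kappa_n\bar\phi_{n+2}(0)}{\kappa_{n+1}\bar\phi_{n+1}(0)}z_j\Theta^*_n(z_j)\Theta^*_{n+1}(z_j)+V(z_j)^2,$$ $$\text{(c)}\quad \Big[\Omega_{n-1}(z_j)-\frac{\kappa_{n-1}^2}{\kappa_n^2}\frac{\phi_{n+1}(0)}{\phi_n(0)}\Theta_n(z_j)\Big]^2=\frac{\kappa_{n-1}\phi_{n+1}(0)\bar\phi_n(0)}{\kappa_n^3}\Theta_n(z_j)\Theta^*_{n-1}(z_j)+V(z_j)^2,$$ $$\text{(d)}\quad \Big[\Omega^*_{n-1}(z_j)-\frac{\kappa_{n-1}^2}{\kappa_n^2}\frac{\bar\phi_{n+1}(0)}{\bar\phi_n(0)}z_j\Theta^*_n(z_j)\Big]^2=\frac{\kappa_{n-1}\bar\phi_{n+1}(0)\phi_n(0)}{\kappa_n^3}z_j^2\Theta^*_n(z_j)\Theta_{n-1}(z_j)+V(z_j)^2,$$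 $$\text{(e)}\quad \frac{\phi_{n+1}(0)\bar\phi_{n+1}(0)}{\kappa_n^2}z_j\Theta_n(z_j)\Theta_n^*(z_j)+V(z_j)^2=\Big[\Omega_n(z_j)-\frac{\kappa_{n+1}}{\kappa_n}z_j\Theta_n(z_j)\Big]^2,$$ $$\text{(f)}\quad \frac{\phi_{n+1}(0)\bar\phi_{n+1}(0)}{\kappa_n^2}z_j\Theta_n(z_j)\Theta_n^*(z_j)+V(z_j)^2=\Big[\Omega^*_n(z_j)-\frac{\kappa_{n+1}}{\kappa_n}\Theta^*_n(z_j)\Big]^2.$$ -/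

import Mathlib

open Polynomial Complex
open scoped Real

namespace SemiclassicalOPUC

noncomputable section

/-- The normalised integral `∫_𝕋 f(ζ) dζ / (2πiζ)` over the positively oriented unit circle. -/
def torusMean (f : ℂ → ℂ) : ℂ :=
  (2 * (π : ℂ) * I)⁻¹ * ∮ ζ in C(0, 1), f ζ / ζ

/-- The derivative `dw/dζ` along the unit circle at a point `ζ` with `|ζ| = 1`: the derivative of
`t ↦ w (ζ e^{it})` at `t = 0`, divided by `iζ`. Where `w` is holomorphic near `ζ`, this is `w'(ζ)`. -/
def circleDeriv (w : ℂ → ℂ) (ζ : ℂ) : ℂ :=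
  deriv (fun t : ℝ => w (ζ * exp (t * I))) 0 / (I * ζ)

/-- `w` is a regular (generic) semi-classical weight on the unit circle, `W w' = 2 V w`.
Only the values of `w` on the circle matter. The weight is single valued and continuous
on the circle, it is differentiable along the circle away from the zeros of `W`, and its derivative
is integrable; zeros of `W` on the circle are allowed. -/
structure IsRegularSemiclassicalWeight (W V : ℂ[X]) (w : ℂ → ℂ) : Prop where
  two_le_natDegree : 2 ≤ W.natDegree
  degree_lt : V.degree < W.degree
  nodup_roots : W.roots.Nodup
  residue_ne : ∀ z : ℂ, W.IsRoot z → ∀ k : ℕ, 2 * V.eval z / W.derivative.eval z ≠ (k : ℂ)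
  continuousOn : ContinuousOn w (Metric.sphere 0 1)
  differentiableAt : ∀ ζ : ℂ, ‖ζ‖ = 1 → W.eval ζ ≠ 0 →
    DifferentiableAt ℝ (fun t : ℝ => w (ζ * exp (t * I))) 0
  semiclassical : ∀ ζ : ℂ, ‖ζ‖ = 1 → W.eval ζ ≠ 0 →
    W.eval ζ * circleDeriv w ζ = 2 * V.eval ζ * w ζ
  circleIntegrable_deriv : CircleIntegrable (circleDeriv w) 0 1

/-- `φ n`, `φb n` (written `φ_n`, `φ̄_n` on paper, the bar not being complex conjugation) form a
system of bi-orthonormal polynomials for the weight `w`, with equal leading coefficients. -/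
structure IsBiorthonormal (w : ℂ → ℂ) (φ φb : ℕ → ℂ[X]) : Prop where
  natDegree_left : ∀ n, (φ n).natDegree = n
  natDegree_right : ∀ n, (φb n).natDegree = n
  leadingCoeff_eq : ∀ n, (φb n).leadingCoeff = (φ n).leadingCoeff
  orthonormal : ∀ m n, torusMean (fun ζ => w ζ * (φ m).eval ζ * (φb n).eval (starRingEnd ℂ ζ))
    = if m = n then 1 else 0

/-- The reciprocal polynomial `φ*_n(z) = z^n φ̄_n(1/z)`. -/
def recip (φb : ℕ → ℂ[X]) (n : ℕ) : ℂ[X] := (φb n).reflect n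

/-- The Carathéodory function `F`. -/
def caratheodory (w : ℂ → ℂ) (z : ℂ) : ℂ :=
  torusMean (fun ζ => (ζ + z) / (ζ - z) * w ζ)

/-- The polynomial of the second kind `ψ_n`, as a function of `z`. -/
def psi (w : ℂ → ℂ) (φ : ℕ → ℂ[X]) (n : ℕ) (z : ℂ) : ℂ :=
  if n = 0 then 1 / (φ 0).leadingCoeff
  else torusMean (fun ζ => (ζ + z) / (ζ - z) * w ζ * ((φ n).eval ζ - (φ n).eval z))

/-- The reciprocal polynomial of the second kind `ψ*_n`, as a function of `z`. -/
def psiStar (w : ℂ → ℂ) (φb : ℕ → ℂ[X]) (n : ℕ) (z : ℂ) : ℂ :=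
  if n = 0 then 1 / (φb 0).leadingCoeff
  else -torusMean (fun ζ => (ζ + z) / (ζ - z) * w ζ *
    (z ^ n * (φb n).eval (starRingEnd ℂ ζ) - (recip φb n).eval z))

/-- The associated function `ε_n = ψ_n + F φ_n`. -/
def eps (w : ℂ → ℂ) (φ : ℕ → ℂ[X]) (n : ℕ) (z : ℂ) : ℂ :=
  psi w φ n z + caratheodory w z * (φ n).eval z

/-- The associated function `ε*_n = ψ*_n - F φ*_n`. -/
def epsStar (w : ℂ → ℂ) (φb : ℕ → ℂ[X]) (n : ℕ) (z : ℂ) : ℂ :=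
  psiStar w φb n z - caratheodory w z * (recip φb n).eval z

/-- The spectral derivative relations that define the coefficient functions `Θ_n` and `Ω_n`:
`W φ_n' = Θ_n φ_{n+1} - (Ω_n + V) φ_n` and, off the unit circle,
`W ε_n' = Θ_n ε_{n+1} - (Ω_n - V) ε_n`. -/
structure IsCoeffPair (W V : ℂ[X]) (w : ℂ → ℂ) (φ : ℕ → ℂ[X]) (n : ℕ) (p : ℂ[X] × ℂ[X]) :
    Prop where
  poly : W * (φ n).derivative = p.1 * φ (n + 1) - (p.2 + V) * φ n
  assoc : ∀ z : ℂ, ‖z‖ ≠ 1 → W.eval z * deriv (eps w φ n) z =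
    p.1.eval z * eps w φ (n + 1) z - (p.2.eval z - V.eval z) * eps w φ n z

/-- The spectral derivative relations that define the coefficient functions `Θ*_n` and `Ω*_n`:
`W φ*_n' = -Θ*_n φ*_{n+1} + (Ω*_n - V) φ*_n` and, off the unit circle,
`W ε*_n' = -Θ*_n ε*_{n+1} + (Ω*_n + V) ε*_n`. -/
structure IsCoeffPairStar (W V : ℂ[X]) (w : ℂ → ℂ) (φb : ℕ → ℂ[X]) (n : ℕ) (p : ℂ[X] × ℂ[X]) :
    Prop where
  poly : W * (recip φb n).derivative =
    -(p.1 * recip φb (n + 1)) + (p.2 - V) * recip φb n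
  assoc : ∀ z : ℂ, ‖z‖ ≠ 1 → W.eval z * deriv (epsStar w φb n) z =
    -(p.1.eval z * epsStar w φb (n + 1) z) + (p.2.eval z + V.eval z) * epsStar w φb n z

open Classical in
/-- The pair `(Θ_n, Ω_n)`: the polynomials in the spectral derivative relations. (The main statement
contains that they exist and are unique, so the second branch is never taken there.) -/
def coeffPair (W V : ℂ[X]) (w : ℂ → ℂ) (φ : ℕ → ℂ[X]) (n : ℕ) : ℂ[X] × ℂ[X] :=
  if h : ∃ p, IsCoeffPair W V w φ n p then h.choose else 0

open Classical in
/-- The pair `(Θ*_n, Ω*_n)`: the polynomials in the starred spectral derivative relations. -/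
def coeffPairStar (W V : ℂ[X]) (w : ℂ → ℂ) (φb : ℕ → ℂ[X]) (n : ℕ) : ℂ[X] × ℂ[X] :=
  if h : ∃ p, IsCoeffPairStar W V w φb n p then h.choose else 0

end

end SemiclassicalOPUC

namespace SemiclassicalOPUC

/-! From `W w' = 2 V w`, integration by parts on the circle gives `W F' = 2 V F + U` with a
polynomial `U` (`exists_caratheodory_ode`). Hence the derivative relations for `φ_n` and `ε_n = ψ_n
+ F φ_n` together amount to two relations between polynomials, one for `φ_n` and one for `ψ_n`;
likewise for `φ*_n` and `χ_n = -ψ*_n` (`assoc_relation_iff`). In this form they can be evaluated at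
every zero of `W`, even at one on the circle, where nothing is assumed about `ε_n`.

At a zero of `W` the derivative terms drop out. Take two of the functions `φ_k`, `φ*_k` as a basis
and let `A` be the matrix of coefficients in their derivative relations. Then `A` kills the column
`P` of their values and sends the column `R` of the corresponding second-kind values to `u P - 2 v
R`, where `u`, `v` are the values of `U`, `V`. Away from `0` the columns are independent, because
the Casoratian of `(φ_n, ψ_n)` and `(φ*_n, χ_n)` is `-2 z^n`. So `A` has trace `-2v` and determinant
`0`, which is a bilinear identity in its entries (`trace_and_bilinear_identity`). The six identities
are this one fact in five bases: `(φ_n, φ_{n+1})`, `(φ*_n, φ*_{n+1})`, `(φ_n, φ*_n)` (which gives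
two of them), `(φ_{n+1}, φ*_n)` and `(φ*_{n+1}, φ_n)`; the Szegő recurrences rewrite the derivative
relations in each basis.

Existence and uniqueness of the coefficients is Cramer's rule (`existsUnique_coefficients`). The
determinant is a nonzero constant times a power of `z`, and the division leaves polynomials because
biorthogonality makes `ε_n` and `ε*_n` vanish at `0` to the matching order, and because `W(0) = 0`.
-/

open MeasureTheory Set Filter Topology Metric

/-! ### Cauchy transforms over the unit circle -/

/-- The Cauchy transform `(2πi)⁻¹ ∮ g(ζ) / (ζ - z) dζ` over the unit circle. -/
noncomputable def cauchyTransform (g : ℂ → ℂ) (z : ℂ) : ℂ :=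
  (2 * (π : ℂ) * I)⁻¹ * ∮ ζ in C(0, 1), g ζ / (ζ - z)

theorem torusMean_eq_cauchyTransform (g : ℂ → ℂ) : torusMean g = cauchyTransform g 0 := by
  simp [torusMean, cauchyTransform]

theorem sub_ne_zero_of_mem_sphere {z ζ : ℂ} (hz : ‖z‖ ≠ 1) (hζ : ζ ∈ sphere (0 : ℂ) 1) :
    ζ - z ≠ 0 := by
  intro h
  rw [sub_eq_zero] at h
  subst h
  exact hz (by simpa using hζ)

theorem ne_zero_of_mem_sphere {ζ : ℂ} (hζ : ζ ∈ sphere (0 : ℂ) 1) : ζ ≠ 0 := by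
  simpa using sub_ne_zero_of_mem_sphere (z := 0) (by simp) hζ

theorem circleIntegrable_mul {g k : ℂ → ℂ} (hg : CircleIntegrable g 0 1)
    (hk : ContinuousOn k (sphere 0 1)) : CircleIntegrable (fun ζ => k ζ * g ζ) 0 1 := by
  refine CircleIntegrable.continuousOn_mul (f := g) (g := k) hg ?_
  simpa using hk

theorem circleIntegrable_div_sub {g : ℂ → ℂ} (hg : CircleIntegrable g 0 1) {z : ℂ}
    (hz : ‖z‖ ≠ 1) : CircleIntegrable (fun ζ => g ζ / (ζ - z)) 0 1 := by
  have := circleIntegrable_mul hg (k := fun ζ => (ζ - z)⁻¹)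
    (ContinuousOn.inv₀ (by fun_prop) fun ζ hζ => sub_ne_zero_of_mem_sphere hz hζ)
  simpa only [div_eq_inv_mul] using this

theorem cauchyTransform_congr {g h : ℂ → ℂ} (H : EqOn g h (sphere 0 1)) (z : ℂ) :
    cauchyTransform g z = cauchyTransform h z := by
  unfold cauchyTransform
  congr 1
  exact circleIntegral.integral_congr zero_le_one fun ζ hζ => by simp only [H hζ]

theorem torusMean_congr {g h : ℂ → ℂ} (H : EqOn g h (sphere 0 1)) :
    torusMean g = torusMean h := by
  simpa only [torusMean_eq_cauchyTransform] using cauchyTransform_congr H 0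

theorem cauchyTransform_add {g h : ℂ → ℂ} (hg : CircleIntegrable g 0 1)
    (hh : CircleIntegrable h 0 1) {z : ℂ} (hz : ‖z‖ ≠ 1) :
    cauchyTransform (fun ζ => g ζ + h ζ) z = cauchyTransform g z + cauchyTransform h z := by
  unfold cauchyTransform
  rw [← mul_add, ← circleIntegral.integral_add (circleIntegrable_div_sub hg hz)
    (circleIntegrable_div_sub hh hz)]
  simp only [add_div]

theorem cauchyTransform_const_mul (a : ℂ) (g : ℂ → ℂ) (z : ℂ) :
    cauchyTransform (fun ζ => a * g ζ) z = a * cauchyTransform g z := by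
  unfold cauchyTransform
  simp only [mul_div_assoc, circleIntegral.integral_const_mul]
  ring

theorem torusMean_add {g h : ℂ → ℂ} (hg : CircleIntegrable g 0 1) (hh : CircleIntegrable h 0 1) :
    torusMean (fun ζ => g ζ + h ζ) = torusMean g + torusMean h := by
  simpa only [torusMean_eq_cauchyTransform] using cauchyTransform_add hg hh (by simp)

theorem torusMean_const_mul (a : ℂ) (g : ℂ → ℂ) :
    torusMean (fun ζ => a * g ζ) = a * torusMean g := by
  simpa only [torusMean_eq_cauchyTransform] using cauchyTransform_const_mul a g 0

/-- This is `ζ / (ζ - z) = z / (ζ - z) + 1` under the integral. -/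
theorem cauchyTransform_id_mul {g : ℂ → ℂ} (hg : CircleIntegrable g 0 1) {z : ℂ} (hz : ‖z‖ ≠ 1) :
    cauchyTransform (fun ζ => ζ * g ζ) z =
      z * cauchyTransform g z + torusMean (fun ζ => ζ * g ζ) := by
  unfold cauchyTransform torusMean
  rw [mul_left_comm, ← mul_add, ← circleIntegral.integral_const_mul z,
    ← circleIntegral.integral_add]
  · congr 1
    refine circleIntegral.integral_congr zero_le_one fun ζ hζ => ?_
    have := sub_ne_zero_of_mem_sphere hz hζ
    have := ne_zero_of_mem_sphere hζ
    simp only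
    field_simp
    ring
  · exact circleIntegrable_mul (circleIntegrable_div_sub hg hz) (by fun_prop)
  · have := circleIntegrable_div_sub (circleIntegrable_mul hg (k := fun ζ => ζ) (by fun_prop))
      (z := 0) (by simp)
    simpa using this

/-- Partial fractions: `(ζ + z) / ((ζ - z) ζ) = 2 / (ζ - z) - 1 / ζ`. -/
theorem torusMean_kernel_mul {g : ℂ → ℂ} (hg : CircleIntegrable g 0 1) {z : ℂ} (hz : ‖z‖ ≠ 1) :
    torusMean (fun ζ => (ζ + z) / (ζ - z) * g ζ) = 2 * cauchyTransform g z - torusMean g := by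
  unfold cauchyTransform torusMean
  rw [mul_left_comm, ← mul_sub, ← circleIntegral.integral_const_mul 2,
    ← circleIntegral.integral_sub]
  · congr 1
    refine circleIntegral.integral_congr zero_le_one fun ζ hζ => ?_
    have := sub_ne_zero_of_mem_sphere hz hζ
    have := ne_zero_of_mem_sphere hζ
    simp only
    field_simp
    ring
  · exact circleIntegrable_mul (circleIntegrable_div_sub hg hz) (by fun_prop)
  · simpa using circleIntegrable_div_sub hg (z := 0) (by simp)

/-- Multiplying the density by a polynomial multiplies the Cauchy transform by it, up to adding a
polynomial. -/
theorem exists_cauchyTransform_polynomial_mul {g : ℂ → ℂ} (hg : CircleIntegrable g 0 1)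
    (p : ℂ[X]) : ∃ q : ℂ[X], ∀ z : ℂ, ‖z‖ ≠ 1 →
      cauchyTransform (fun ζ => p.eval ζ * g ζ) z =
        p.eval z * cauchyTransform g z + q.eval z := by
  have hint : ∀ p : ℂ[X], CircleIntegrable (fun ζ => p.eval ζ * g ζ) 0 1 := fun p =>
    circleIntegrable_mul hg (by fun_prop)
  induction p using Polynomial.induction_on with
  | C a => exact ⟨0, fun z _ => by simp [cauchyTransform_const_mul]⟩
  | add p₁ p₂ h₁ h₂ =>
    obtain ⟨q₁, h₁⟩ := h₁
    obtain ⟨q₂, h₂⟩ := h₂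
    refine ⟨q₁ + q₂, fun z hz => ?_⟩
    simp only [eval_add, add_mul]
    rw [cauchyTransform_add (hint _) (hint _) hz, h₁ z hz, h₂ z hz]
    ring
  | monomial n a h =>
    obtain ⟨q, h⟩ := h
    refine ⟨X * q + C (torusMean fun ζ => ζ * ((C a * X ^ n).eval ζ * g ζ)), fun z hz => ?_⟩
    have : (fun ζ => (C a * X ^ (n + 1)).eval ζ * g ζ) =
        fun ζ => ζ * ((C a * X ^ n).eval ζ * g ζ) := by
      funext ζ
      simp only [eval_mul, eval_C, eval_pow, eval_X]
      ring
    rw [this, cauchyTransform_id_mul (hint _) hz, h z hz]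
    simp only [eval_mul, eval_C, eval_pow, eval_X, eval_add]
    ring

/-- Taylor expansion of the Cauchy transform at `0`, with remainder. -/
theorem cauchyTransform_eq_sum_add {g : ℂ → ℂ} (hg : CircleIntegrable g 0 1) {z : ℂ}
    (hz : ‖z‖ ≠ 1) (n : ℕ) :
    cauchyTransform g z = ∑ k ∈ Finset.range n, torusMean (fun ζ => ζ⁻¹ ^ k * g ζ) * z ^ k +
      z ^ n * cauchyTransform (fun ζ => ζ⁻¹ ^ n * g ζ) z := by
  induction n with
  | zero => simp
  | succ n ih =>
    have hint : CircleIntegrable (fun ζ => ζ⁻¹ ^ (n + 1) * g ζ) 0 1 :=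
      circleIntegrable_mul hg (ContinuousOn.pow (ContinuousOn.inv₀ (by fun_prop) fun ζ hζ =>
        ne_zero_of_mem_sphere hζ) _)
    have h : EqOn (fun ζ : ℂ => ζ⁻¹ ^ n * g ζ) (fun ζ => ζ * (ζ⁻¹ ^ (n + 1) * g ζ))
        (sphere 0 1) := fun ζ hζ => by
      have := ne_zero_of_mem_sphere hζ
      simp only [pow_succ]
      field_simp
    rw [ih, Finset.sum_range_succ, cauchyTransform_congr h, cauchyTransform_id_mul hint hz,
      ← torusMean_congr h]
    ring

theorem hasDerivAt_cauchyTransform {g : ℂ → ℂ} (hg : CircleIntegrable g 0 1) {z : ℂ}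
    (hz : ‖z‖ ≠ 1) :
    HasDerivAt (cauchyTransform g)
      ((2 * (π : ℂ) * I)⁻¹ * ∮ ζ in C(0, 1), g ζ / (ζ - z) ^ 2) z := by
  unfold cauchyTransform
  refine HasDerivAt.const_mul _ ?_
  -- Half the distance from `z` to the circle: points of the ball of radius `δ` about `z` stay at
  -- distance at least `δ` from the circle, which yields the dominating function.
  set δ := |‖z‖ - 1| / 2 with hδ
  have hδ0 : 0 < δ := by
    have : ‖z‖ - 1 ≠ 0 := sub_ne_zero.2 hz
    positivity
  have hsep : ∀ x ∈ ball z δ, ∀ ζ : ℂ, ‖ζ‖ = 1 → δ ≤ ‖ζ - x‖ := by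
    intro x hx ζ hζ
    have h1 : ‖x - z‖ < δ := by simpa [dist_eq_norm] using hx
    have h2 : |‖z‖ - ‖ζ‖| ≤ ‖z - ζ‖ := abs_norm_sub_norm_le z ζ
    have h3 : ‖z - ζ‖ ≤ ‖ζ - x‖ + ‖x - z‖ := by
      rw [norm_sub_rev z ζ]
      exact norm_sub_le_norm_sub_add_norm_sub ζ x z
    rw [hζ] at h2
    linarith
  have hx1 : ∀ x ∈ ball z δ, ‖x‖ ≠ 1 := by
    intro x hx h
    have := hsep x hx x h
    simp only [sub_self, norm_zero] at this
    linarith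
  have hmeas : ∀ x, ‖x‖ ≠ 1 → CircleIntegrable (fun ζ => g ζ / (ζ - x) ^ 2) 0 1 := by
    intro x hx
    simpa only [div_div, ← sq] using circleIntegrable_div_sub (circleIntegrable_div_sub hg hx) hx
  unfold circleIntegral
  refine (intervalIntegral.hasDerivAt_integral_of_dominated_loc_of_deriv_le
    (E := ℂ) (F := fun x t => deriv (circleMap 0 1) t • (g (circleMap 0 1 t) /
      (circleMap 0 1 t - x)))
    (F' := fun x t => deriv (circleMap 0 1) t • (g (circleMap 0 1 t) /
      (circleMap 0 1 t - x) ^ 2))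
    (bound := fun t => ‖g (circleMap 0 1 t)‖ / δ ^ 2) (ball_mem_nhds z hδ0) ?_ ?_ ?_ ?_ ?_ ?_).2
  · filter_upwards [ball_mem_nhds z hδ0] with x hx
    exact (circleIntegrable_div_sub hg (hx1 x hx)).out.def'.aestronglyMeasurable
  · exact (circleIntegrable_div_sub hg hz).out
  · exact (hmeas z hz).out.def'.aestronglyMeasurable
  · refine Eventually.of_forall fun t _ x hx => ?_
    have h := hsep x hx (circleMap 0 1 t) (by simp)
    simp only [deriv_circleMap, smul_eq_mul, norm_mul, norm_I, norm_circleMap_zero, abs_one,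
      norm_div, norm_pow, one_mul]
    gcongr
  · exact hg.norm.div_const _
  · refine Eventually.of_forall fun t _ x hx => ?_
    have h : circleMap 0 1 t - x ≠ 0 := sub_ne_zero_of_mem_sphere (hx1 x hx) (by simp)
    simp only [smul_eq_mul]
    refine HasDerivAt.const_mul _ ?_
    simp only [div_eq_mul_inv]
    refine HasDerivAt.const_mul _ ?_
    simpa using ((hasDerivAt_id x).const_sub (circleMap 0 1 t)).fun_inv h

/-! ### The differential equation of the Carathéodory function -/

theorem circleMap_zero_one_add (t s : ℝ) :
    circleMap 0 1 (t + s) = circleMap 0 1 t * exp (s * I) := by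
  simp [circleMap, add_mul, Complex.exp_add]

/-- Away from the zeros of `W`, the angular derivative of a regular semi-classical weight. -/
theorem IsRegularSemiclassicalWeight.hasDerivAt_comp_circleMap {W V : ℂ[X]} {w : ℂ → ℂ}
    (hw : IsRegularSemiclassicalWeight W V w) {t : ℝ} (ht : W.eval (circleMap 0 1 t) ≠ 0) :
    HasDerivAt (fun s => w (circleMap 0 1 s))
      (circleDeriv w (circleMap 0 1 t) * (circleMap 0 1 t * I)) t := by
  have h := (hw.differentiableAt _ (by simp) ht).hasDerivAt
  have h0 : circleMap 0 1 t ≠ 0 := ne_zero_of_mem_sphere (by simp)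
  have h1 : deriv (fun s : ℝ => w (circleMap 0 1 t * exp (s * I))) 0 =
      circleDeriv w (circleMap 0 1 t) * (circleMap 0 1 t * I) := by
    rw [circleDeriv, mul_comm (circleMap 0 1 t) I,
      div_mul_cancel₀ _ (mul_ne_zero I_ne_zero h0)]
  rw [h1] at h
  simp only [← circleMap_zero_one_add] at h
  rw [← sub_self t] at h
  simpa using h.comp_sub_const t t

theorem IsRegularSemiclassicalWeight.countable_angles {W V : ℂ[X]} {w : ℂ → ℂ}
    (hw : IsRegularSemiclassicalWeight W V w) :
    {t : ℝ | W.eval (circleMap 0 1 t) = 0}.Countable := by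
  have hW : W ≠ 0 := by
    rintro rfl
    simpa using hw.two_le_natDegree
  have : {z : ℂ | W.IsRoot z}.Countable := (Polynomial.finite_setOfPred_isRoot hW).countable
  exact this.preimage_circleMap 0 one_ne_zero

/-- Integration by parts on the circle. -/
theorem IsRegularSemiclassicalWeight.integral_div_sub_sq {W V : ℂ[X]} {w : ℂ → ℂ}
    (hw : IsRegularSemiclassicalWeight W V w) {z : ℂ} (hz : ‖z‖ ≠ 1) :
    ∮ ζ in C(0, 1), w ζ / (ζ - z) ^ 2 = ∮ ζ in C(0, 1), circleDeriv w ζ / (ζ - z) := by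
  have hwi : CircleIntegrable w 0 1 := hw.continuousOn.circleIntegrable zero_le_one
  have h1 : CircleIntegrable (fun ζ => circleDeriv w ζ / (ζ - z)) 0 1 :=
    circleIntegrable_div_sub hw.circleIntegrable_deriv hz
  have h2 : CircleIntegrable (fun ζ => w ζ / (ζ - z) ^ 2) 0 1 := by
    simpa only [div_div, ← sq] using circleIntegrable_div_sub (circleIntegrable_div_sub hwi hz) hz
  have hne : ∀ t, circleMap 0 1 t - z ≠ 0 := fun t => sub_ne_zero_of_mem_sphere hz (by simp)
  refine (sub_eq_zero.1 ?_).symm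
  rw [← circleIntegral.integral_sub h1 h2]
  have hsub := (h1.sub h2).out
  -- The primitive `w(ζ) / (ζ - z)` is continuous on the whole circle and differentiable off the
  -- countably many angles where `W` vanishes. Its boundary terms cancel because `w` is
  -- single-valued.
  have key := MeasureTheory.integral_eq_of_hasDerivAt_off_countable_of_le
    (fun t => w (circleMap 0 1 t) / (circleMap 0 1 t - z)) _ Real.two_pi_pos.le
    hw.countable_angles (Continuous.continuousOn ?_) ?_ hsub
  · unfold circleIntegral
    refine Eq.trans key ?_
    have : circleMap 0 1 (2 * π) = circleMap 0 1 0 := by simp [circleMap]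
    simp only [this, sub_self]
  · refine Continuous.div ?_ (by fun_prop) hne
    exact hw.continuousOn.comp_continuous (by fun_prop) (by simp)
  · intro t ht
    refine ((hw.hasDerivAt_comp_circleMap ht.2).fun_div
      ((hasDerivAt_circleMap 0 1 t).sub_const z) (hne t)).congr_deriv ?_
    have := hne t
    simp only [deriv_circleMap, smul_eq_mul, Pi.sub_apply]
    field_simp

theorem IsRegularSemiclassicalWeight.cauchyTransform_mul_deriv {W V : ℂ[X]} {w : ℂ → ℂ}
    (hw : IsRegularSemiclassicalWeight W V w) (z : ℂ) :
    cauchyTransform (fun ζ => W.eval ζ * circleDeriv w ζ) z =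
      cauchyTransform (fun ζ => (2 * V).eval ζ * w ζ) z := by
  unfold cauchyTransform circleIntegral
  congr 1
  refine intervalIntegral.integral_congr_ae ?_
  filter_upwards [hw.countable_angles.ae_notMem volume] with t ht _
  simp only [hw.semiclassical _ (by simp : ‖circleMap 0 1 t‖ = 1) ht, eval_mul, eval_ofNat]

theorem caratheodory_eq {w : ℂ → ℂ} (hw : CircleIntegrable w 0 1) {z : ℂ} (hz : ‖z‖ ≠ 1) :
    caratheodory w z = 2 * cauchyTransform w z - torusMean w :=
  torusMean_kernel_mul hw hz

theorem eventually_norm_ne_one {z : ℂ} (hz : ‖z‖ ≠ 1) : ∀ᶠ x in 𝓝 z, ‖x‖ ≠ 1 :=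
  continuous_norm.continuousAt.eventually_ne hz

/-- The first order differential equation `W F' = 2 V F + U` of the Carathéodory function. -/
theorem IsRegularSemiclassicalWeight.exists_caratheodory_ode {W V : ℂ[X]} {w : ℂ → ℂ}
    (hw : IsRegularSemiclassicalWeight W V w) : ∃ U : ℂ[X], ∀ z : ℂ, ‖z‖ ≠ 1 →
      DifferentiableAt ℂ (caratheodory w) z ∧
      W.eval z * deriv (caratheodory w) z = 2 * V.eval z * caratheodory w z + U.eval z := by
  have hwi : CircleIntegrable w 0 1 := hw.continuousOn.circleIntegrable zero_le_one
  obtain ⟨q₁, h₁⟩ := exists_cauchyTransform_polynomial_mul hw.circleIntegrable_deriv W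
  obtain ⟨q₂, h₂⟩ := exists_cauchyTransform_polynomial_mul hwi (2 * V)
  -- The densities `W w'` and `2 V w` have equal Cauchy transforms. Pulling `W` and `2 V` out leaves
  -- the remainders `q₁` and `q₂`; the last term comes from the constant in `F = 2 C(w) - torusMean
  -- w`, where `C(w)` is the Cauchy transform of `w`.
  refine ⟨2 * q₂ - 2 * q₁ + 2 * V * C (torusMean w), fun z hz => ?_⟩
  have hd : HasDerivAt (caratheodory w) (2 * cauchyTransform (circleDeriv w) z) z := by
    have h := ((hasDerivAt_cauchyTransform hwi hz).const_mul 2).sub_const (torusMean w)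
    rw [hw.integral_div_sub_sq hz] at h
    refine h.congr_of_eventuallyEq ?_
    filter_upwards [eventually_norm_ne_one hz] with x hx
    exact caratheodory_eq hwi hx
  refine ⟨hd.differentiableAt, ?_⟩
  rw [hd.deriv, caratheodory_eq hwi hz]
  have h3 := h₁ z hz
  rw [hw.cauchyTransform_mul_deriv, h₂ z hz] at h3
  simp only [eval_add, eval_sub, eval_mul, eval_ofNat, eval_C] at h3 ⊢
  linear_combination -2 * h3

/-! ### The biorthogonality pairing and the Szegő recurrences -/

theorem exists_eq_C_mul_add_of_degree_lt_succ {q p : ℂ[X]} {d : ℕ} (hq : q.natDegree = d)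
    (hq0 : q.leadingCoeff ≠ 0) (hp : p.degree < (d + 1 : ℕ)) :
    ∃ (c : ℂ) (r : ℂ[X]), p = C c * q + r ∧ r.degree < d := by
  refine ⟨p.coeff d / q.leadingCoeff, p - C (p.coeff d / q.leadingCoeff) * q, by ring, ?_⟩
  rw [degree_lt_iff_coeff_zero] at hp ⊢
  intro m hm
  rcases hm.eq_or_lt with rfl | hm
  · have : q.coeff d = q.leadingCoeff := by rw [leadingCoeff, hq]
    rw [coeff_sub, coeff_C_mul, this, div_mul_cancel₀ _ hq0, sub_self]
  · rw [coeff_sub, coeff_C_mul, hp m hm, coeff_eq_zero_of_natDegree_lt (p := q) (by rwa [hq])]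
    simp

/-- A functional that vanishes on polynomials of degrees `0, …, d - 1` vanishes in degree `< d`. -/
theorem linearMap_eq_zero_of_degree_lt {φ : ℕ → ℂ[X]} (hd : ∀ n, (φ n).natDegree = n)
    (h0 : ∀ n, (φ n).leadingCoeff ≠ 0) (l : ℂ[X] →ₗ[ℂ] ℂ) {d : ℕ} (hl : ∀ i < d, l (φ i) = 0)
    {p : ℂ[X]} (hp : p.degree < d) : l p = 0 := by
  induction d generalizing p with
  | zero =>
    have : p = 0 := by simpa using hp
    simp [this]
  | succ d ih =>
    obtain ⟨c, r, rfl, hr⟩ := exists_eq_C_mul_add_of_degree_lt_succ (hd d) (h0 d) hp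
    rw [map_add, ih (fun i hi => hl i (by omega)) hr, ← smul_eq_C_mul, map_smul, hl d (by omega)]
    simp

theorem circleIntegrable_weight_mul {w : ℂ → ℂ} (hw : ContinuousOn w (sphere 0 1)) (p q : ℂ[X]) :
    CircleIntegrable (fun ζ => w ζ * p.eval ζ * q.eval (starRingEnd ℂ ζ)) 0 1 := by
  refine ContinuousOn.circleIntegrable zero_le_one ((hw.mul (by fun_prop)).mul ?_)
  exact (q.continuous.comp continuous_conj).continuousOn

/-- The pairing `⟨p, q⟩ = ∫ w(ζ) p(ζ) q(ζ̄)` of polynomials with respect to a weight. -/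
noncomputable def weightPairing (w : ℂ → ℂ) (hw : ContinuousOn w (sphere 0 1)) :
    ℂ[X] →ₗ[ℂ] ℂ[X] →ₗ[ℂ] ℂ :=
  LinearMap.mk₂ ℂ (fun p q => torusMean fun ζ => w ζ * p.eval ζ * q.eval (starRingEnd ℂ ζ))
    (fun p₁ p₂ q => by
      rw [← torusMean_add (circleIntegrable_weight_mul hw _ _) (circleIntegrable_weight_mul hw _ _)]
      simp only [eval_add]
      congr! 2
      ring)
    (fun c p q => by
      rw [smul_eq_mul, ← torusMean_const_mul]
      simp only [eval_smul, smul_eq_mul]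
      congr! 2
      ring)
    (fun p q₁ q₂ => by
      rw [← torusMean_add (circleIntegrable_weight_mul hw _ _) (circleIntegrable_weight_mul hw _ _)]
      simp only [eval_add]
      congr! 2
      ring)
    (fun c p q => by
      rw [smul_eq_mul, ← torusMean_const_mul]
      simp only [eval_smul, smul_eq_mul]
      congr! 2
      ring)

theorem conj_eq_inv_of_mem_sphere {ζ : ℂ} (hζ : ζ ∈ sphere (0 : ℂ) 1) :
    starRingEnd ℂ ζ = ζ⁻¹ := by
  rw [Complex.inv_def, Complex.normSq_eq_norm_sq]
  simp_all

section

variable {w : ℂ → ℂ} {φ φb : ℕ → ℂ[X]}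

theorem weightPairing_apply (hw : ContinuousOn w (sphere 0 1)) (p q : ℂ[X]) :
    weightPairing w hw p q = torusMean fun ζ => w ζ * p.eval ζ * q.eval (starRingEnd ℂ ζ) := rfl

theorem weightPairing_X_mul_X_mul (hw : ContinuousOn w (sphere 0 1)) (p q : ℂ[X]) :
    weightPairing w hw (X * p) (X * q) = weightPairing w hw p q := by
  simp only [weightPairing_apply]
  refine torusMean_congr fun ζ hζ => ?_
  have h := ne_zero_of_mem_sphere hζ
  simp only [eval_mul, eval_X, conj_eq_inv_of_mem_sphere hζ]
  field_simp

theorem IsBiorthonormal.eval_recip (hφ : IsBiorthonormal w φ φb) (n : ℕ) {ζ : ℂ} (hζ : ζ ≠ 0) :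
    (recip φb n).eval ζ = ζ ^ n * (φb n).eval ζ⁻¹ := by
  let _ : Invertible ζ⁻¹ := invertibleOfNonzero (inv_ne_zero hζ)
  have h := eval₂_reflect_mul_pow (RingHom.id ℂ) ζ⁻¹ n (φb n) (hφ.natDegree_right n).le
  simp only [invOf_eq_inv, inv_inv] at h
  rw [← eval₂_id, ← eval₂_id (p := φb n), ← h, recip, mul_comm, mul_assoc, ← mul_pow,
    inv_mul_cancel₀ hζ, one_pow, mul_one]

/-- On the circle `φ*_n(ζ) ζ^{-j} = ζ^{n-j} φ̄_n(ζ̄)`. This turns the orthogonality of `φ̄_n` to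
degrees below `n` into the orthogonality of `φ*_n` to `ζ, …, ζ^n`. -/
theorem IsBiorthonormal.weightPairing_recip (hφ : IsBiorthonormal w φ φb)
    (hw : ContinuousOn w (sphere 0 1)) {j n : ℕ} (hj : j ≤ n) :
    weightPairing w hw (recip φb n) (X ^ j) = weightPairing w hw (X ^ (n - j)) (φb n) := by
  simp only [weightPairing_apply]
  refine torusMean_congr fun ζ hζ => ?_
  have h := ne_zero_of_mem_sphere hζ
  obtain ⟨k, rfl⟩ := Nat.exists_eq_add_of_le hj
  simp only [eval_pow, eval_X, conj_eq_inv_of_mem_sphere hζ, hφ.eval_recip _ h]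
  rw [Nat.add_sub_cancel_left, pow_add, inv_pow]
  field_simp

theorem IsBiorthonormal.weightPairing_eq (hφ : IsBiorthonormal w φ φb)
    (hw : ContinuousOn w (sphere 0 1)) (m n : ℕ) :
    weightPairing w hw (φ m) (φb n) = if m = n then 1 else 0 :=
  hφ.orthonormal m n

theorem IsBiorthonormal.leadingCoeff_ne_zero (hφ : IsBiorthonormal w φ φb) (n : ℕ) :
    (φ n).leadingCoeff ≠ 0 := by
  intro h
  have := hφ.orthonormal n n
  rw [leadingCoeff_eq_zero.1 h] at this
  simp [torusMean, circleIntegral] at this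

theorem IsBiorthonormal.leadingCoeff_right_ne_zero (hφ : IsBiorthonormal w φ φb) (n : ℕ) :
    (φb n).leadingCoeff ≠ 0 :=
  hφ.leadingCoeff_eq n ▸ hφ.leadingCoeff_ne_zero n

theorem IsBiorthonormal.weightPairing_left_eq_zero (hφ : IsBiorthonormal w φ φb)
    (hw : ContinuousOn w (sphere 0 1)) {n : ℕ} {q : ℂ[X]} (hq : q.degree < n) :
    weightPairing w hw (φ n) q = 0 :=
  linearMap_eq_zero_of_degree_lt hφ.natDegree_right hφ.leadingCoeff_right_ne_zero
    (weightPairing w hw (φ n)) (fun i hi => by rw [hφ.weightPairing_eq, if_neg hi.ne']) hq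

theorem IsBiorthonormal.weightPairing_right_eq_zero (hφ : IsBiorthonormal w φ φb)
    (hw : ContinuousOn w (sphere 0 1)) {n : ℕ} {p : ℂ[X]} (hp : p.degree < n) :
    weightPairing w hw p (φb n) = 0 :=
  linearMap_eq_zero_of_degree_lt hφ.natDegree_left hφ.leadingCoeff_ne_zero
    ((weightPairing w hw).flip (φb n))
    (fun i hi => by rw [LinearMap.flip_apply, hφ.weightPairing_eq, if_neg hi.ne]) hp

theorem IsBiorthonormal.weightPairing_X_pow_right (hφ : IsBiorthonormal w φ φb)
    (hw : ContinuousOn w (sphere 0 1)) (n : ℕ) :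
    weightPairing w hw (φ n) (X ^ n) * (φ n).leadingCoeff = 1 := by
  obtain ⟨c, r, h, hr⟩ := exists_eq_C_mul_add_of_degree_lt_succ (q := X ^ n) (p := φb n)
    (natDegree_X_pow n) (by simp) (by
      rw [degree_lt_iff_coeff_zero]
      intro m hm
      exact coeff_eq_zero_of_natDegree_lt (by rw [hφ.natDegree_right]; omega))
  have hc : c = (φ n).leadingCoeff := by
    have h1 := congrArg (fun p => coeff p n) h
    simp only [coeff_add, coeff_C_mul, coeff_X_pow_self, mul_one] at h1
    rw [coeff_eq_zero_of_degree_lt hr, add_zero] at h1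
    rw [← h1, ← hφ.leadingCoeff_eq, leadingCoeff, hφ.natDegree_right]
  have h1 := hφ.weightPairing_eq hw n n
  rw [h, ← smul_eq_C_mul, map_add, map_smul, hφ.weightPairing_left_eq_zero hw hr, hc] at h1
  simpa [mul_comm] using h1

theorem IsBiorthonormal.weightPairing_X_pow_left (hφ : IsBiorthonormal w φ φb)
    (hw : ContinuousOn w (sphere 0 1)) (n : ℕ) :
    weightPairing w hw (X ^ n) (φb n) * (φ n).leadingCoeff = 1 := by
  obtain ⟨c, r, h, hr⟩ := exists_eq_C_mul_add_of_degree_lt_succ (q := X ^ n) (p := φ n)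
    (natDegree_X_pow n) (by simp) (by
      rw [degree_lt_iff_coeff_zero]
      intro m hm
      exact coeff_eq_zero_of_natDegree_lt (by rw [hφ.natDegree_left]; omega))
  have hc : c = (φ n).leadingCoeff := by
    have h1 := congrArg (fun p => coeff p n) h
    simp only [coeff_add, coeff_C_mul, coeff_X_pow_self, mul_one] at h1
    rw [coeff_eq_zero_of_degree_lt hr, add_zero] at h1
    rw [← h1, leadingCoeff, hφ.natDegree_left]
  have h1 := hφ.weightPairing_eq hw n n
  rw [h, ← smul_eq_C_mul, map_add, map_smul, LinearMap.add_apply,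
    hφ.weightPairing_right_eq_zero hw hr, hc] at h1
  simpa [mul_comm] using h1

theorem IsBiorthonormal.weightPairing_recip_eq_zero (hφ : IsBiorthonormal w φ φb)
    (hw : ContinuousOn w (sphere 0 1)) {j n : ℕ} (h1 : 1 ≤ j) (hj : j ≤ n) :
    weightPairing w hw (recip φb n) (X ^ j) = 0 := by
  rw [hφ.weightPairing_recip hw hj]
  refine hφ.weightPairing_right_eq_zero hw ?_
  rw [degree_X_pow]
  exact_mod_cast (by omega : n - j < n)

theorem IsBiorthonormal.weightPairing_recip_one (hφ : IsBiorthonormal w φ φb)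
    (hw : ContinuousOn w (sphere 0 1)) (n : ℕ) :
    weightPairing w hw (recip φb n) 1 * (φ n).leadingCoeff = 1 := by
  rw [← pow_zero X, hφ.weightPairing_recip hw (Nat.zero_le n), Nat.sub_zero,
    hφ.weightPairing_X_pow_left]

/-- The pairing is nondegenerate on polynomials of degree `< d`. -/
theorem IsBiorthonormal.eq_zero_of_weightPairing (hφ : IsBiorthonormal w φ φb)
    (hw : ContinuousOn w (sphere 0 1)) {d : ℕ} {r : ℂ[X]} (hr : r.degree < d)
    (h : ∀ j < d, weightPairing w hw r (X ^ j) = 0) : r = 0 := by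
  induction d generalizing r with
  | zero => simpa using hr
  | succ d ih =>
    obtain ⟨c, s, rfl, hs⟩ := exists_eq_C_mul_add_of_degree_lt_succ (hφ.natDegree_left d)
      (hφ.leadingCoeff_ne_zero d) hr
    -- Pairing with `φ̄_d` isolates the coefficient `c`, since `s` has lower degree.
    have h1 : weightPairing w hw (C c * φ d + s) (φb d) = 0 :=
      linearMap_eq_zero_of_degree_lt (φ := fun j => X ^ j) (fun n => natDegree_X_pow n)
        (fun n => by simp) (weightPairing w hw (C c * φ d + s)) h (by
          rw [degree_lt_iff_coeff_zero]
          intro m hm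
          exact coeff_eq_zero_of_natDegree_lt (by rw [hφ.natDegree_right]; omega))
    rw [← smul_eq_C_mul, map_add, map_smul, LinearMap.add_apply, LinearMap.smul_apply,
      hφ.weightPairing_eq, hφ.weightPairing_right_eq_zero hw hs] at h1
    have hc : c = 0 := by simpa using h1
    subst hc
    rw [C_0, zero_mul, zero_add] at h ⊢
    exact ih hs fun j hj => h j (by omega)

/-- A polynomial of degree at most `n` without constant term that is orthogonal to `ζ, …, ζⁿ`
vanishes. -/
theorem IsBiorthonormal.eq_zero_of_coeff_zero (hφ : IsBiorthonormal w φ φb)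
    (hw : ContinuousOn w (sphere 0 1)) {n : ℕ} {q : ℂ[X]} (hq : q.degree < (n + 1 : ℕ))
    (h0 : q.coeff 0 = 0) (h : ∀ j, 1 ≤ j → j ≤ n → weightPairing w hw q (X ^ j) = 0) : q = 0 := by
  have hX : q = X * q.divX := by
    conv_lhs => rw [← X_mul_divX_add q, h0, C_0, add_zero]
  have : q.divX = 0 := by
    refine hφ.eq_zero_of_weightPairing hw (d := n) ?_ fun j hj => ?_
    · rw [degree_lt_iff_coeff_zero] at hq ⊢
      intro m hm
      rw [coeff_divX]
      exact hq _ (by omega)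
    · rw [← weightPairing_X_mul_X_mul, ← hX, ← pow_succ']
      exact h _ (by omega) (by omega)
  rw [hX, this, mul_zero]

theorem coeff_recip {j n : ℕ} (hj : j ≤ n) :
    (recip φb n).coeff j = (φb n).coeff (n - j) := by
  rw [recip, coeff_reflect, revAt_le hj]

theorem IsBiorthonormal.coeff_recip_of_lt (hφ : IsBiorthonormal w φ φb) {j n : ℕ} (hj : n < j) :
    (recip φb n).coeff j = 0 := by
  rw [recip, coeff_reflect, revAt_eq_self_of_lt hj]
  exact coeff_eq_zero_of_natDegree_lt (by rwa [hφ.natDegree_right])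

theorem IsBiorthonormal.coeff_recip_zero (hφ : IsBiorthonormal w φ φb) (n : ℕ) :
    (recip φb n).coeff 0 = (φ n).leadingCoeff := by
  rw [coeff_recip (Nat.zero_le n), ← hφ.leadingCoeff_eq, leadingCoeff, hφ.natDegree_right,
    Nat.sub_zero]

theorem coeff_recip_self (n : ℕ) :
    (recip φb n).coeff n = (φb n).eval 0 := by
  rw [coeff_recip le_rfl, Nat.sub_self, coeff_zero_eq_eval_zero]

theorem IsBiorthonormal.coeff_left_self (hφ : IsBiorthonormal w φ φb) (n : ℕ) :
    (φ n).coeff n = (φ n).leadingCoeff := by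
  rw [leadingCoeff, hφ.natDegree_left]

theorem IsBiorthonormal.coeff_left_of_lt (hφ : IsBiorthonormal w φ φb) {j n : ℕ} (hj : n < j) :
    (φ n).coeff j = 0 :=
  coeff_eq_zero_of_natDegree_lt (by rwa [hφ.natDegree_left])

theorem IsBiorthonormal.weightPairing_X_mul_left (hφ : IsBiorthonormal w φ φb)
    (hw : ContinuousOn w (sphere 0 1)) {j n : ℕ} (h1 : 1 ≤ j) (hj : j ≤ n) :
    weightPairing w hw (X * φ n) (X ^ j) = 0 := by
  obtain ⟨k, rfl⟩ := Nat.exists_eq_add_of_le' h1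
  rw [pow_succ', weightPairing_X_mul_X_mul]
  refine hφ.weightPairing_left_eq_zero hw ?_
  rw [degree_X_pow]
  exact_mod_cast hj

theorem IsBiorthonormal.weightPairing_left_X_pow (hφ : IsBiorthonormal w φ φb)
    (hw : ContinuousOn w (sphere 0 1)) {j n : ℕ} (hj : j < n) :
    weightPairing w hw (φ n) (X ^ j) = 0 := by
  refine hφ.weightPairing_left_eq_zero hw ?_
  rw [degree_X_pow]
  exact_mod_cast hj

/-- The Szegő recurrence for `φ_{n+1}`. -/
theorem IsBiorthonormal.left_succ (hφ : IsBiorthonormal w φ φb)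
    (hw : ContinuousOn w (sphere 0 1)) (n : ℕ) :
    C (φ n).leadingCoeff * φ (n + 1) =
      C (φ (n + 1)).leadingCoeff * (X * φ n) + C ((φ (n + 1)).eval 0) * recip φb n := by
  rw [← sub_eq_zero]
  -- In the difference of the two sides, the coefficients of `z^{n+1}` cancel, the constant terms
  -- cancel because `φ*_n(0) = κ_n`, and each term is orthogonal to `ζ, …, ζ^n`.
  refine hφ.eq_zero_of_coeff_zero hw (n := n) ?_ ?_ ?_
  · rw [degree_lt_iff_coeff_zero]
    intro m hm
    obtain ⟨m, rfl⟩ := Nat.exists_eq_add_of_le' (Nat.le_of_add_left_le hm)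
    simp only [coeff_sub, coeff_add, coeff_C_mul, coeff_X_mul]
    rw [hφ.coeff_recip_of_lt (by omega)]
    rcases (by omega : n = m ∨ n < m) with rfl | h
    · rw [hφ.coeff_left_self, hφ.coeff_left_self]
      ring
    · rw [hφ.coeff_left_of_lt h, hφ.coeff_left_of_lt (by omega)]
      ring
  · simp only [coeff_sub, coeff_add, coeff_C_mul, hφ.coeff_recip_zero, coeff_X_mul_zero]
    simp only [coeff_zero_eq_eval_zero]
    ring
  · intro j h1 h2
    simp only [← smul_eq_C_mul, map_sub, map_add, map_smul, LinearMap.sub_apply,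
      LinearMap.add_apply, LinearMap.smul_apply]
    rw [hφ.weightPairing_left_X_pow hw (by omega), hφ.weightPairing_X_mul_left hw h1 h2,
      hφ.weightPairing_recip_eq_zero hw h1 h2]
    simp

/-- The Szegő recurrence for `φ*_{n+1}`. -/
theorem IsBiorthonormal.recip_succ (hφ : IsBiorthonormal w φ φb)
    (hw : ContinuousOn w (sphere 0 1)) (n : ℕ) :
    C (φ n).leadingCoeff * recip φb (n + 1) =
      C (φ (n + 1)).leadingCoeff * recip φb n + C ((φb (n + 1)).eval 0) * (X * φ n) := by
  rw [← sub_eq_zero]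
  refine hφ.eq_zero_of_coeff_zero hw (n := n) ?_ ?_ ?_
  · rw [degree_lt_iff_coeff_zero]
    intro m hm
    obtain ⟨m, rfl⟩ := Nat.exists_eq_add_of_le' (Nat.le_of_add_left_le hm)
    simp only [coeff_sub, coeff_add, coeff_C_mul, coeff_X_mul]
    rw [hφ.coeff_recip_of_lt (n := n) (by omega)]
    rcases (by omega : n = m ∨ n < m) with rfl | h
    · rw [hφ.coeff_left_self, coeff_recip_self]
      ring
    · rw [hφ.coeff_left_of_lt h, hφ.coeff_recip_of_lt (by omega)]
      ring
  · simp only [coeff_sub, coeff_add, coeff_C_mul, hφ.coeff_recip_zero, coeff_X_mul_zero]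
    ring
  · intro j h1 h2
    simp only [← smul_eq_C_mul, map_sub, map_add, map_smul, LinearMap.sub_apply,
      LinearMap.add_apply, LinearMap.smul_apply]
    rw [hφ.weightPairing_recip_eq_zero hw h1 (by omega), hφ.weightPairing_X_mul_left hw h1 h2,
      hφ.weightPairing_recip_eq_zero hw h1 h2]
    simp

/-- Pairing both Szegő recurrences with `ζ^{n+1}` gives two equations containing the one unknown
`⟨φ*_n, ζ^{n+1}⟩`; eliminating it leaves this identity. -/
theorem IsBiorthonormal.leadingCoeff_succ_sq (hφ : IsBiorthonormal w φ φb)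
    (hw : ContinuousOn w (sphere 0 1)) (n : ℕ) :
    (φ (n + 1)).leadingCoeff ^ 2 =
      (φ n).leadingCoeff ^ 2 + (φ (n + 1)).eval 0 * (φb (n + 1)).eval 0 := by
  have h1 := congrArg (fun p => weightPairing w hw p (X ^ (n + 1))) (hφ.left_succ hw n)
  have h2 := congrArg (fun p => weightPairing w hw p (X ^ (n + 1))) (hφ.recip_succ hw n)
  have h3 := hφ.weightPairing_X_pow_right hw n
  have h4 := hφ.weightPairing_X_pow_right hw (n + 1)
  have h5 := hφ.weightPairing_recip_eq_zero hw (j := n + 1) (n := n + 1) (by omega) le_rfl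
  have h6 : weightPairing w hw (X * φ n) (X ^ (n + 1)) = weightPairing w hw (φ n) (X ^ n) := by
    rw [pow_succ', weightPairing_X_mul_X_mul]
  simp only [← smul_eq_C_mul, map_add, map_smul, LinearMap.add_apply, LinearMap.smul_apply,
    smul_eq_mul, h5, h6] at h1 h2
  have hκ := hφ.leadingCoeff_ne_zero n
  have hκ' := hφ.leadingCoeff_ne_zero (n + 1)
  have h3' := eq_one_div_of_mul_eq_one_left h3
  have h4' := eq_one_div_of_mul_eq_one_left h4
  rw [h3'] at h1 h2
  rw [h4'] at h1
  field_simp at h1 h2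
  linear_combination (φ (n + 1)).eval 0 * h2 - h1

end

/-! ### Associated functions and polynomials of the second kind -/

theorem norm_ne_one_of_mem_ball {z : ℂ} (hz : z ∈ ball (0 : ℂ) 1) : ‖z‖ ≠ 1 := by
  have : ‖z‖ < 1 := by simpa using hz
  exact this.ne

theorem eq_of_eval_eq_off_circle {p q : ℂ[X]} (h : ∀ z : ℂ, ‖z‖ ≠ 1 → p.eval z = q.eval z) :
    p = q := by
  refine Polynomial.eq_of_infinite_eval_eq p q (Set.Infinite.mono (s := ball (0 : ℂ) 1) ?_ ?_)
  · intro z hz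
    exact h z (norm_ne_one_of_mem_ball hz)
  · exact infinite_of_mem_nhds 0 (ball_mem_nhds 0 one_pos)

section

variable {w : ℂ → ℂ} {φ φb : ℕ → ℂ[X]}

theorem circleIntegrable_weight_mul_eval (hw : ContinuousOn w (sphere 0 1)) (p : ℂ[X]) :
    CircleIntegrable (fun ζ => w ζ * p.eval ζ) 0 1 :=
  ContinuousOn.circleIntegrable zero_le_one (hw.mul (by fun_prop))

/-- The associated function `(πi)⁻¹ ∮ w(ζ) p(ζ) / (ζ - z) dζ` of a polynomial. -/
noncomputable def weightTransform (w : ℂ → ℂ) (p : ℂ[X]) (z : ℂ) : ℂ :=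
  2 * cauchyTransform (fun ζ => w ζ * p.eval ζ) z

theorem weightTransform_add (hw : ContinuousOn w (sphere 0 1)) (p q : ℂ[X]) {z : ℂ}
    (hz : ‖z‖ ≠ 1) :
    weightTransform w (p + q) z = weightTransform w p z + weightTransform w q z := by
  unfold weightTransform
  rw [← mul_add, ← cauchyTransform_add (circleIntegrable_weight_mul_eval hw p)
    (circleIntegrable_weight_mul_eval hw q) hz]
  simp only [eval_add, mul_add]

theorem weightTransform_C_mul (a : ℂ) (p : ℂ[X]) (z : ℂ) :
    weightTransform w (C a * p) z = a * weightTransform w p z := by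
  unfold weightTransform
  rw [mul_left_comm a, ← cauchyTransform_const_mul a]
  congr 2
  funext ζ
  simp only [eval_mul, eval_C]
  ring

theorem weightTransform_X_mul (hw : ContinuousOn w (sphere 0 1)) (p : ℂ[X]) {z : ℂ}
    (hz : ‖z‖ ≠ 1) :
    weightTransform w (X * p) z =
      z * weightTransform w p z + 2 * weightPairing w hw (X * p) 1 := by
  have h := cauchyTransform_id_mul (circleIntegrable_weight_mul_eval hw p) hz
  unfold weightTransform
  rw [weightPairing_apply]
  simp only [eval_mul, eval_X, eval_one, mul_one, mul_left_comm (w _)]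
  rw [h]
  ring

theorem exists_weightTransform_eq (hw : ContinuousOn w (sphere 0 1)) (p : ℂ[X]) :
    ∃ q : ℂ[X], ∀ z : ℂ, ‖z‖ ≠ 1 →
      weightTransform w p z = q.eval z + caratheodory w z * p.eval z := by
  have hwi := hw.circleIntegrable zero_le_one
  obtain ⟨q, hq⟩ := exists_cauchyTransform_polynomial_mul hwi p
  refine ⟨2 * q + C (torusMean w) * p, fun z hz => ?_⟩
  unfold weightTransform
  simp only [mul_comm (w _)]
  rw [hq z hz, caratheodory_eq hwi hz]
  simp only [eval_add, eval_mul, eval_ofNat, eval_C]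
  ring

theorem weightPairing_X_pow (hw : ContinuousOn w (sphere 0 1)) (p : ℂ[X]) (k : ℕ) :
    weightPairing w hw p (X ^ k) = torusMean fun ζ => ζ⁻¹ ^ k * (w ζ * p.eval ζ) := by
  rw [weightPairing_apply]
  refine torusMean_congr fun ζ hζ => ?_
  simp only [eval_pow, eval_X, conj_eq_inv_of_mem_sphere hζ]
  ring

/-- Taylor expansion of the associated function at `0`. -/
theorem exists_weightTransform_expansion (hw : ContinuousOn w (sphere 0 1)) (p : ℂ[X]) (n : ℕ) :
    ∃ h : ℂ → ℂ, DifferentiableOn ℂ h (ball 0 1) ∧ ∀ z ∈ ball (0 : ℂ) 1, weightTransform w p z =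
      2 * ∑ k ∈ Finset.range n, weightPairing w hw p (X ^ k) * z ^ k + z ^ n * h z := by
  have hg := circleIntegrable_weight_mul_eval hw p
  have hn : CircleIntegrable (fun ζ => ζ⁻¹ ^ n * (w ζ * p.eval ζ)) 0 1 :=
    circleIntegrable_mul hg (ContinuousOn.pow (ContinuousOn.inv₀ (by fun_prop) fun ζ hζ =>
      ne_zero_of_mem_sphere hζ) _)
  refine ⟨fun z => 2 * cauchyTransform (fun ζ => ζ⁻¹ ^ n * (w ζ * p.eval ζ)) z,
    fun z hz => ?_, fun z hz => ?_⟩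
  · exact ((hasDerivAt_cauchyTransform hn (norm_ne_one_of_mem_ball hz)).const_mul
      2).differentiableAt.differentiableWithinAt
  · unfold weightTransform
    rw [cauchyTransform_eq_sum_add hg (norm_ne_one_of_mem_ball hz) n]
    simp only [weightPairing_X_pow]
    ring

theorem IsBiorthonormal.left_zero (hφ : IsBiorthonormal w φ φb) :
    φ 0 = C (φ 0).leadingCoeff := by
  have h := eq_C_of_natDegree_eq_zero (hφ.natDegree_left 0)
  rw [hφ.coeff_left_self] at h
  exact h

theorem IsBiorthonormal.recip_zero (hφ : IsBiorthonormal w φ φb) :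
    recip φb 0 = C (φ 0).leadingCoeff := by
  ext j
  rcases Nat.eq_zero_or_pos j with rfl | hj
  · rw [hφ.coeff_recip_zero, coeff_C_zero]
  · rw [hφ.coeff_recip_of_lt hj, coeff_C_of_ne_zero hj.ne']

theorem IsBiorthonormal.torusMean_mul_sq (hφ : IsBiorthonormal w φ φb)
    (hw : ContinuousOn w (sphere 0 1)) : torusMean w * (φ 0).leadingCoeff ^ 2 = 1 := by
  have h := hφ.weightPairing_recip_one hw 0
  rw [weightPairing_apply, hφ.recip_zero] at h
  simp only [eval_C, eval_one, mul_one, mul_comm (w _)] at h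
  rw [torusMean_const_mul] at h
  linear_combination h

/-- For `n ≥ 1` the correction `torusMean (w φ_n)` of the kernel vanishes by orthogonality. For `n =
0` the prescribed value `ψ_0 = 1/κ_0` cancels the constant in `F`, because `torusMean w = 1/κ_0²`.
-/
theorem IsBiorthonormal.eps_eq (hφ : IsBiorthonormal w φ φb)
    (hw : ContinuousOn w (sphere 0 1)) (n : ℕ) {z : ℂ} (hz : ‖z‖ ≠ 1) :
    eps w φ n z = weightTransform w (φ n) z := by
  have hwi := hw.circleIntegrable zero_le_one
  have hκ := hφ.leadingCoeff_ne_zero 0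
  unfold eps psi weightTransform
  rcases Nat.eq_zero_or_pos n with rfl | hn
  · rw [if_pos rfl, hφ.left_zero, caratheodory_eq hwi hz]
    simp only [eval_C, mul_comm (w _), leadingCoeff_C]
    rw [cauchyTransform_const_mul]
    have := hφ.torusMean_mul_sq hw
    field_simp
    linear_combination -this
  · rw [if_neg hn.ne']
    have hg := circleIntegrable_weight_mul_eval hw (φ n)
    have h1 : torusMean (fun ζ => w ζ * (φ n).eval ζ) = 0 := by
      have := hφ.weightPairing_left_X_pow hw hn
      rw [weightPairing_X_pow] at this
      simpa using this
    have h2 : CircleIntegrable (fun ζ => -(φ n).eval z * w ζ) 0 1 :=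
      circleIntegrable_mul hwi (by fun_prop)
    have h3 : (fun ζ => (ζ + z) / (ζ - z) * w ζ * ((φ n).eval ζ - (φ n).eval z)) =
        fun ζ => (ζ + z) / (ζ - z) * (w ζ * (φ n).eval ζ + -(φ n).eval z * w ζ) := by
      funext ζ
      ring
    rw [h3, torusMean_kernel_mul (g := fun ζ => w ζ * (φ n).eval ζ + -(φ n).eval z * w ζ)
      (hg.add h2) hz, caratheodory_eq hwi hz]
    rw [cauchyTransform_add hg h2 hz, torusMean_add hg h2, h1, cauchyTransform_const_mul,
      torusMean_const_mul]
    ring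

theorem IsBiorthonormal.sum_weightPairing_recip (hφ : IsBiorthonormal w φ φb)
    (hw : ContinuousOn w (sphere 0 1)) {k n : ℕ} (hk : 1 ≤ k) (hn : k ≤ n + 1) (z : ℂ) :
    ∑ j ∈ Finset.range k, weightPairing w hw (recip φb n) (X ^ j) * z ^ j =
      1 / (φ n).leadingCoeff := by
  obtain ⟨k, rfl⟩ := Nat.exists_eq_add_of_le' hk
  rw [Finset.sum_range_succ', Finset.sum_eq_zero, zero_add, pow_zero, pow_zero, mul_one]
  · exact eq_one_div_of_mul_eq_one_left (hφ.weightPairing_recip_one hw n)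
  · intro j hj
    rw [hφ.weightPairing_recip_eq_zero hw (by omega) (by have := Finset.mem_range.1 hj; omega),
      zero_mul]

/-- For `n ≥ 1`, `ψ*_n` is defined with `z^n φ̄_n(ζ̄)` in place of `φ*_n(ζ)`. Expanding the Cauchy
transform of `w φ*_n` to order `n` compares the two: of the Taylor coefficients only the constant
one, `1/κ_n`, survives, whence the term `2/κ_n`. -/
theorem IsBiorthonormal.epsStar_eq (hφ : IsBiorthonormal w φ φb)
    (hw : ContinuousOn w (sphere 0 1)) (n : ℕ) {z : ℂ} (hz : ‖z‖ ≠ 1) :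
    epsStar w φb n z = 2 / (φ n).leadingCoeff - weightTransform w (recip φb n) z := by
  have hwi := hw.circleIntegrable zero_le_one
  have hκ := hφ.leadingCoeff_ne_zero 0
  unfold epsStar psiStar weightTransform
  rcases Nat.eq_zero_or_pos n with rfl | hn
  · rw [if_pos rfl, hφ.recip_zero, caratheodory_eq hwi hz, hφ.leadingCoeff_eq]
    simp only [eval_C, mul_comm (w _)]
    rw [cauchyTransform_const_mul]
    have := hφ.torusMean_mul_sq hw
    field_simp
    linear_combination this
  · rw [if_neg hn.ne']
    have hg := circleIntegrable_weight_mul_eval hw (recip φb n)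
    have hb : CircleIntegrable (fun ζ => w ζ * (φb n).eval (starRingEnd ℂ ζ)) 0 1 := by
      simpa using circleIntegrable_weight_mul hw 1 (φb n)
    have h1 : torusMean (fun ζ => w ζ * (φb n).eval (starRingEnd ℂ ζ)) = 0 := by
      have := hφ.weightPairing_right_eq_zero hw (n := n) (p := 1) (by simpa using hn)
      rw [weightPairing_apply] at this
      simpa using this
    have h2 : CircleIntegrable (fun ζ => -(recip φb n).eval z * w ζ) 0 1 :=
      circleIntegrable_mul hwi (by fun_prop)
    have hb' : CircleIntegrable (fun ζ => z ^ n * (w ζ * (φb n).eval (starRingEnd ℂ ζ))) 0 1 :=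
      circleIntegrable_mul hb (by fun_prop)
    have h3 : (fun ζ => (ζ + z) / (ζ - z) * w ζ *
        (z ^ n * (φb n).eval (starRingEnd ℂ ζ) - (recip φb n).eval z)) =
        fun ζ => (ζ + z) / (ζ - z) * (z ^ n * (w ζ * (φb n).eval (starRingEnd ℂ ζ)) +
          -(recip φb n).eval z * w ζ) := by
      funext ζ
      ring
    have h4 : cauchyTransform (fun ζ => ζ⁻¹ ^ n * (w ζ * (recip φb n).eval ζ)) z =
        cauchyTransform (fun ζ => w ζ * (φb n).eval (starRingEnd ℂ ζ)) z := by
      refine cauchyTransform_congr (fun ζ hζ => ?_) z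
      have h := ne_zero_of_mem_sphere hζ
      simp only [hφ.eval_recip n h, conj_eq_inv_of_mem_sphere hζ, inv_pow]
      field_simp
    rw [h3, torusMean_kernel_mul
      (g := fun ζ => z ^ n * (w ζ * (φb n).eval (starRingEnd ℂ ζ)) + -(recip φb n).eval z * w ζ)
      (hb'.add h2) hz, caratheodory_eq hwi hz]
    rw [cauchyTransform_add hb' h2 hz, torusMean_add hb' h2, cauchyTransform_const_mul,
      cauchyTransform_const_mul, torusMean_const_mul, torusMean_const_mul, h1,
      cauchyTransform_eq_sum_add hg hz n, h4]
    simp only [← weightPairing_X_pow hw]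
    rw [hφ.sum_weightPairing_recip hw hn (by omega)]
    ring

/-- The transform of the Szegő recurrence, with `-ε*_n` in the role of `φ*_n`. The constants
produced by multiplication by `z` and by `2/κ_n` are balanced by pairing the same recurrence with
`1`. -/
theorem IsBiorthonormal.eps_succ (hφ : IsBiorthonormal w φ φb)
    (hw : ContinuousOn w (sphere 0 1)) (n : ℕ) {z : ℂ} (hz : ‖z‖ ≠ 1) :
    (φ n).leadingCoeff * eps w φ (n + 1) z = (φ (n + 1)).leadingCoeff * (z * eps w φ n z) +
      (φ (n + 1)).eval 0 * -epsStar w φb n z := by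
  have h := congrArg (fun p => weightTransform w p z) (hφ.left_succ hw n)
  have h' := congrArg (fun p => weightPairing w hw p 1) (hφ.left_succ hw n)
  have h0 := hφ.weightPairing_left_X_pow hw (Nat.succ_pos n)
  have h1 := eq_one_div_of_mul_eq_one_left (hφ.weightPairing_recip_one hw n)
  rw [pow_zero] at h0
  simp only [← smul_eq_C_mul, map_add, map_smul, LinearMap.add_apply, LinearMap.smul_apply,
    smul_eq_mul, h1] at h'
  simp only [weightTransform_add hw _ _ hz, weightTransform_C_mul,
    weightTransform_X_mul hw _ hz] at h
  rw [hφ.eps_eq hw _ hz, hφ.eps_eq hw _ hz, hφ.epsStar_eq hw _ hz]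
  linear_combination h - 2 * h' + 2 * (φ n).leadingCoeff * h0

theorem IsBiorthonormal.epsStar_succ (hφ : IsBiorthonormal w φ φb)
    (hw : ContinuousOn w (sphere 0 1)) (n : ℕ) {z : ℂ} (hz : ‖z‖ ≠ 1) :
    (φ n).leadingCoeff * -epsStar w φb (n + 1) z =
      (φ (n + 1)).leadingCoeff * -epsStar w φb n z +
        (φb (n + 1)).eval 0 * (z * eps w φ n z) := by
  have h := congrArg (fun p => weightTransform w p z) (hφ.recip_succ hw n)
  have h' := congrArg (fun p => weightPairing w hw p 1) (hφ.recip_succ hw n)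
  have h0 := eq_one_div_of_mul_eq_one_left (hφ.weightPairing_recip_one hw (n + 1))
  have h1 := eq_one_div_of_mul_eq_one_left (hφ.weightPairing_recip_one hw n)
  simp only [← smul_eq_C_mul, map_add, map_smul, LinearMap.add_apply, LinearMap.smul_apply,
    smul_eq_mul, h0, h1] at h'
  simp only [weightTransform_add hw _ _ hz, weightTransform_C_mul,
    weightTransform_X_mul hw _ hz] at h
  rw [hφ.eps_eq hw _ hz, hφ.epsStar_eq hw _ hz, hφ.epsStar_eq hw _ hz]
  linear_combination h - 2 * h'

/-- Polynomials of the second kind: the polynomials `ψ n` and `χ n = -ψ*_n` with their recurrence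
relations, and their Casoratian with `φ n`, `φ*_n`. -/
structure IsSecondKind (w : ℂ → ℂ) (φ φb ψ χ : ℕ → ℂ[X]) : Prop where
  eps_eq : ∀ n z, ‖z‖ ≠ 1 → eps w φ n z = (ψ n).eval z + caratheodory w z * (φ n).eval z
  neg_epsStar_eq : ∀ n z, ‖z‖ ≠ 1 →
    -epsStar w φb n z = (χ n).eval z + caratheodory w z * (recip φb n).eval z
  left_succ : ∀ n, C (φ n).leadingCoeff * ψ (n + 1) =
    C (φ (n + 1)).leadingCoeff * (X * ψ n) + C ((φ (n + 1)).eval 0) * χ n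
  right_succ : ∀ n, C (φ n).leadingCoeff * χ (n + 1) =
    C (φ (n + 1)).leadingCoeff * χ n + C ((φb (n + 1)).eval 0) * (X * ψ n)
  casoratian : ∀ n, φ n * χ n - recip φb n * ψ n = C (-2) * X ^ n

theorem IsBiorthonormal.exists_isSecondKind (hφ : IsBiorthonormal w φ φb)
    (hw : ContinuousOn w (sphere 0 1)) : ∃ ψ χ, IsSecondKind w φ φb ψ χ := by
  choose ψ hψ using fun n => exists_weightTransform_eq hw (φ n)
  choose χ' hχ' using fun n => exists_weightTransform_eq hw (recip φb n)
  have he : ∀ n z, ‖z‖ ≠ 1 →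
      eps w φ n z = (ψ n).eval z + caratheodory w z * (φ n).eval z := fun n z hz => by
    rw [hφ.eps_eq hw n hz, hψ n z hz]
  set χ : ℕ → ℂ[X] := fun n => χ' n - C (2 / (φ n).leadingCoeff) with hχdef
  have hs : ∀ n z, ‖z‖ ≠ 1 → -epsStar w φb n z =
      (χ n).eval z + caratheodory w z * (recip φb n).eval z := fun n z hz => by
    rw [hφ.epsStar_eq hw n hz, hχ' n z hz, hχdef]
    simp only [eval_sub, eval_C]
    ring
  have hl : ∀ n, C (φ n).leadingCoeff * ψ (n + 1) =
      C (φ (n + 1)).leadingCoeff * (X * ψ n) + C ((φ (n + 1)).eval 0) * χ n := fun n => by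
    refine eq_of_eval_eq_off_circle fun z hz => ?_
    have h1 := hφ.eps_succ hw n hz
    have h2 := congrArg (eval z) (hφ.left_succ hw n)
    rw [he _ z hz, he _ z hz, hs _ z hz] at h1
    simp only [eval_add, eval_mul, eval_C, eval_X] at h2 ⊢
    linear_combination h1 - caratheodory w z * h2
  have hr : ∀ n, C (φ n).leadingCoeff * χ (n + 1) =
      C (φ (n + 1)).leadingCoeff * χ n + C ((φb (n + 1)).eval 0) * (X * ψ n) := fun n => by
    refine eq_of_eval_eq_off_circle fun z hz => ?_
    have h1 := hφ.epsStar_succ hw n hz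
    have h2 := congrArg (eval z) (hφ.recip_succ hw n)
    rw [he _ z hz, hs _ z hz, hs _ z hz] at h1
    simp only [eval_add, eval_mul, eval_C, eval_X] at h2 ⊢
    linear_combination h1 - caratheodory w z * h2
  refine ⟨ψ, χ, he, hs, hl, hr, fun n => ?_⟩
  induction n with
  | zero =>
    refine eq_of_eval_eq_off_circle fun z hz => ?_
    have h1 := he 0 z hz
    have h2 := hs 0 z hz
    have hκ := hφ.leadingCoeff_ne_zero 0
    simp only [eps, psi, epsStar, psiStar, if_true, hφ.leadingCoeff_eq, hφ.recip_zero] at h1 h2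
    have h3 : (φ 0).eval z = (φ 0).leadingCoeff := by
      conv_lhs => rw [hφ.left_zero, eval_C]
    simp only [eval_C, eval_mul, eval_sub, hφ.recip_zero, pow_zero, eval_one, h3] at h1 h2 ⊢
    have h4 : (ψ 0).eval z = 1 / (φ 0).leadingCoeff := by linear_combination -h1
    have h5 : (χ 0).eval z = -(1 / (φ 0).leadingCoeff) := by linear_combination -h2
    rw [h4, h5]
    field_simp
    norm_num
  | succ n ih =>
    -- The Szegő transfer matrix, cleared of `1/κ_n`, has determinant `z (κ_{n+1}² - φ_{n+1}(0)
    -- φ̄_{n+1}(0)) = z κ_n²`, so each step multiplies the Casoratian by exactly `z`.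
    have hκ : C ((φ n).leadingCoeff ^ 2) ≠ 0 := by
      rw [Ne, C_eq_zero]
      exact pow_ne_zero 2 (hφ.leadingCoeff_ne_zero n)
    have h1 := hφ.left_succ hw n
    have h2 := hφ.recip_succ hw n
    have h3 := congrArg C (hφ.leadingCoeff_succ_sq hw n)
    refine mul_left_cancel₀ hκ ?_
    simp only [map_add, map_mul, map_pow] at h3 ⊢
    have h4 := congrArg₂ (· * ·) h1 (hr n)
    have h5 := congrArg₂ (· * ·) h2 (hl n)
    rw [pow_succ]
    linear_combination h4 - h5 + (X * (C (φ n).leadingCoeff ^ 2)) * ih +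
      (X * (φ n * χ n - recip φb n * ψ n)) * h3

end

/-! ### Existence and uniqueness of the coefficient functions -/

theorem X_pow_dvd_of_eval_eq {R : ℂ[X]} {k : ℕ} {G : ℂ → ℂ} (hG : ContinuousAt G 0)
    (h : ∀ z ∈ ball (0 : ℂ) 1, R.eval z = z ^ k * G z) : X ^ k ∣ R := by
  induction k generalizing G with
  | zero => simp
  | succ k ih =>
    obtain ⟨S, rfl⟩ := ih (G := fun z => z * G z) (continuousAt_id.mul hG) fun z hz => by
      rw [h z hz, pow_succ, mul_assoc]
    have h0 : S.eval 0 = 0 := by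
      have h1 : Tendsto (fun z => S.eval z) (𝓝[≠] 0) (𝓝 (S.eval 0)) :=
        S.continuous.continuousAt.tendsto.mono_left nhdsWithin_le_nhds
      have h2 : Tendsto (fun z => z * G z) (𝓝[≠] 0) (𝓝 (0 * G 0)) :=
        (continuousAt_id.mul hG).tendsto.mono_left nhdsWithin_le_nhds
      rw [zero_mul] at h2
      refine tendsto_nhds_unique (h1.congr' ?_) h2
      filter_upwards [self_mem_nhdsWithin, mem_nhdsWithin_of_mem_nhds
        (ball_mem_nhds (0 : ℂ) one_pos)] with z hz hz1
      have h3 := h z hz1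
      simp only [eval_mul, eval_pow, eval_X] at h3
      refine mul_left_cancel₀ (pow_ne_zero k hz) ?_
      rw [h3, pow_succ]
      ring
    rw [pow_succ]
    exact mul_dvd_mul_left _ (X_dvd_iff.2 (by rwa [coeff_zero_eq_eval_zero]))

/-- For functions `P = r + F p`, `Q = s + F q` with `W F' = 2 V F + U`, the two derivative
relations with polynomial coefficients amount to two relations between polynomials. -/
theorem assoc_relation_iff {W V U p q r s a b : ℂ[X]} {F P Q : ℂ → ℂ}
    (hF : ∀ z : ℂ, ‖z‖ ≠ 1 → DifferentiableAt ℂ F z ∧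
      W.eval z * deriv F z = 2 * V.eval z * F z + U.eval z)
    (hP : ∀ z : ℂ, ‖z‖ ≠ 1 → P z = r.eval z + F z * p.eval z)
    (hQ : ∀ z : ℂ, ‖z‖ ≠ 1 → Q z = s.eval z + F z * q.eval z)
    (h : W * derivative p = a * p + b * q) :
    (∀ z : ℂ, ‖z‖ ≠ 1 → W.eval z * deriv P z =
      (a.eval z + 2 * V.eval z) * P z + b.eval z * Q z) ↔
    W * derivative r + U * p = (a + 2 * V) * r + b * s := by
  have key : ∀ z : ℂ, ‖z‖ ≠ 1 → (W.eval z * deriv P z =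
      (a.eval z + 2 * V.eval z) * P z + b.eval z * Q z ↔
      (W * derivative r + U * p).eval z = ((a + 2 * V) * r + b * s).eval z) := by
    intro z hz
    have hd : deriv P z =
        (derivative r).eval z + (deriv F z * p.eval z + F z * (derivative p).eval z) := by
      have h1 : P =ᶠ[𝓝 z] fun x => r.eval x + F x * p.eval x := by
        filter_upwards [eventually_norm_ne_one hz] with x hx using hP x hx
      rw [h1.deriv_eq]
      exact ((r.hasDerivAt z).add ((hF z hz).1.hasDerivAt.mul (p.hasDerivAt z))).deriv
    have h2 := congrArg (eval z) h
    have h3 := (hF z hz).2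
    -- The terms containing `F` cancel: `F' p` contributes `2 V F p`, matching the extra `2 V` on
    -- the right, and the rest is `F` times `h`.
    rw [hd, hP z hz, hQ z hz]
    simp only [eval_add, eval_mul, eval_ofNat] at h2 ⊢
    constructor
    · intro h4
      linear_combination h4 - p.eval z * h3 - F z * h2
    · intro h4
      linear_combination h4 + p.eval z * h3 + F z * h2
  constructor
  · intro h1
    exact eq_of_eval_eq_off_circle fun z hz => (key z hz).1 (h1 z hz)
  · intro h1 z hz
    exact (key z hz).2 (congrArg (eval z) h1)

/-- Existence and uniqueness of the coefficients in a pair of derivative relations, by Cramer's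
rule; the divisions are possible because of the vanishing of the associated functions at `0`. -/
theorem existsUnique_coefficients {W V U p q r s : ℂ[X]} {F P Q h₁ h₂ : ℂ → ℂ} {c : ℂ} {k : ℕ}
    (hW0 : W.eval 0 = 0)
    (hF : ∀ z : ℂ, ‖z‖ ≠ 1 → DifferentiableAt ℂ F z ∧
      W.eval z * deriv F z = 2 * V.eval z * F z + U.eval z)
    (hP : ∀ z : ℂ, ‖z‖ ≠ 1 → P z = r.eval z + F z * p.eval z)
    (hQ : ∀ z : ℂ, ‖z‖ ≠ 1 → Q z = s.eval z + F z * q.eval z)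
    (hc : c ≠ 0) (hD : p * s - q * r = C c * X ^ k)
    (hh₁ : DifferentiableOn ℂ h₁ (ball 0 1)) (hh₂ : DifferentiableOn ℂ h₂ (ball 0 1))
    (hP0 : ∀ z ∈ ball (0 : ℂ) 1, P z = z ^ k * h₁ z)
    (hQ0 : ∀ z ∈ ball (0 : ℂ) 1, Q z = z ^ k * h₂ z) :
    ∃! x : ℂ[X] × ℂ[X], W * derivative p = x.1 * p + x.2 * q ∧
      W * derivative r + U * p = (x.1 + 2 * V) * r + x.2 * s := by
  have hb := ball_mem_nhds (0 : ℂ) one_pos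
  have hc₁ : ContinuousAt h₁ 0 := (hh₁.differentiableAt hb).continuousAt
  have hc₂ : ContinuousAt h₂ 0 := (hh₂.differentiableAt hb).continuousAt
  have hc₁' : ContinuousAt (deriv h₁) 0 := (hh₁.analyticAt hb).deriv.continuousAt
  -- Differentiating `z^k h₁` costs one power of `z`; the factor `z` of `W` restores it.
  obtain ⟨W₁, rfl⟩ : X ∣ W :=
    X_dvd_iff.2 (by rwa [coeff_zero_eq_eval_zero])
  set T := X * W₁ * derivative r + U * p - 2 * V * r with hT
  have hTz : ∀ z ∈ ball (0 : ℂ) 1, T.eval z = z ^ k * ((k : ℂ) * W₁.eval z * h₁ z +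
      z * W₁.eval z * deriv h₁ z - 2 * V.eval z * h₁ z) -
      F z * (z * W₁.eval z * (derivative p).eval z) := by
    intro z hz
    have hz1 := norm_ne_one_of_mem_ball hz
    have hnb := isOpen_ball.mem_nhds hz
    have h1 : (fun x => r.eval x + F x * p.eval x) =ᶠ[𝓝 z] fun x => x ^ k * h₁ x := by
      filter_upwards [hnb] with x hx
      rw [← hP x (norm_ne_one_of_mem_ball hx), hP0 x hx]
    have h2 := h1.deriv_eq
    rw [((r.hasDerivAt z).fun_add ((hF z hz1).1.hasDerivAt.fun_mul (p.hasDerivAt z))).deriv,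
      ((hasDerivAt_pow k z).fun_mul (hh₁.differentiableAt hnb).hasDerivAt).deriv] at h2
    have h3 := (hF z hz1).2
    have h4 : r.eval z + F z * p.eval z = z ^ k * h₁ z := h1.self_of_nhds
    have h5 : z * ((k : ℂ) * z ^ (k - 1)) = k * z ^ k := by
      rcases k with _ | k
      · simp
      · rw [Nat.add_sub_cancel, pow_succ]
        ring
    simp only [hT, eval_sub, eval_add, eval_mul, eval_X, eval_ofNat] at h3 ⊢
    linear_combination (z * W₁.eval z) * h2 - p.eval z * h3 - 2 * V.eval z * h4 +
      W₁.eval z * h₁ z * h5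
  -- The numerators in Cramer's rule. The term `-F W p'` of `T` combines with `s` into `Q = s + F q`
  -- here, and with `r` into `P = r + F p` in the next one; both vanish at `0` to order `k`.
  obtain ⟨a, ha⟩ : X ^ k ∣ s * (X * W₁ * derivative p) - q * T := by
    refine X_pow_dvd_of_eval_eq (G := fun z => h₂ z * (z * W₁.eval z * (derivative p).eval z) -
      q.eval z * ((k : ℂ) * W₁.eval z * h₁ z + z * W₁.eval z * deriv h₁ z -
        2 * V.eval z * h₁ z)) (by fun_prop) fun z hz => ?_
    have h1 := hQ z (norm_ne_one_of_mem_ball hz)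
    rw [hQ0 z hz] at h1
    simp only [eval_sub, eval_mul, eval_X, hTz z hz]
    linear_combination -(z * W₁.eval z * (derivative p).eval z) * h1
  obtain ⟨b, hb'⟩ : X ^ k ∣ p * T - r * (X * W₁ * derivative p) := by
    refine X_pow_dvd_of_eval_eq (G := fun z => p.eval z * ((k : ℂ) * W₁.eval z * h₁ z +
      z * W₁.eval z * deriv h₁ z - 2 * V.eval z * h₁ z) -
      h₁ z * (z * W₁.eval z * (derivative p).eval z)) (by fun_prop) fun z hz => ?_
    have h1 := hP z (norm_ne_one_of_mem_ball hz)
    rw [hP0 z hz] at h1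
    simp only [eval_sub, eval_mul, eval_X, hTz z hz]
    linear_combination (z * W₁.eval z * (derivative p).eval z) * h1
  have hcX : C c * X ^ k ≠ (0 : ℂ[X]) := mul_ne_zero (by simpa using hc) (pow_ne_zero k X_ne_zero)
  have hcc : C c⁻¹ * C c = (1 : ℂ[X]) := by rw [← C_mul, inv_mul_cancel₀ hc, C_1]
  refine ⟨(C c⁻¹ * a, C c⁻¹ * b), ⟨?_, ?_⟩, ?_⟩
  · refine mul_left_cancel₀ hcX ?_
    simp only
    linear_combination p * ha + q * hb' - X * W₁ * derivative p * hD -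
      (X ^ k * (a * p + b * q)) * hcc
  · refine mul_left_cancel₀ hcX ?_
    simp only
    linear_combination r * ha + s * hb' - T * hD - (X ^ k * (a * r + b * s)) * hcc +
      (C c * X ^ k) * hT
  · rintro ⟨a', b'⟩ ⟨h1, h2⟩
    simp only at h1 h2
    refine Prod.ext (mul_left_cancel₀ hcX ?_) (mul_left_cancel₀ hcX ?_)
    · simp only
      linear_combination ha - s * h1 + q * h2 - a' * hD - (X ^ k * a) * hcc + q * hT
    · simp only
      linear_combination hb' + r * h1 - p * h2 - b' * hD - (X ^ k * b) * hcc - p * hT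

/-! ### Linear algebra at a zero of `W` -/

/-- A `2 × 2` matrix conjugate to `!![0, u; 0, -2v]` has trace `-2v` and determinant `0`. -/
theorem trace_and_bilinear_identity {a b a' b' p q r s u v : ℂ} (h₁ : a * p + b * q = 0)
    (h₂ : a' * p + b' * q = 0) (h₃ : a * r + b * s = u * p - 2 * v * r)
    (h₄ : a' * r + b' * s = u * q - 2 * v * s) (hD : p * s - q * r ≠ 0) :
    a + b' = -2 * v ∧ (a + v) ^ 2 = v ^ 2 - a' * b := by
  have ht : a + b' = -2 * v := by
    refine mul_right_cancel₀ hD ?_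
    linear_combination s * h₁ + p * h₄ - r * h₂ - q * h₃
  have hd : a * b' - a' * b = 0 := by
    refine mul_right_cancel₀ hD ?_
    linear_combination (b' * s + a' * r) * h₁ - (b * s + a * r) * h₂
  refine ⟨ht, ?_⟩
  -- Substituting `b' = -2v - a` into the vanishing determinant and completing the square.
  linear_combination a * ht - hd

/-- The values at a point `z` of two solutions of the Szegő recurrences and of the coefficients in
their derivative relations, at a zero of `W`. -/
structure ResidueSystem (κ f g : ℕ → ℂ) (z u v : ℂ) (x y r s Θ Ω Θs Ωs : ℕ → ℂ) : Prop where
  κ_ne : ∀ n, κ n ≠ 0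
  z_ne : z ≠ 0
  norm : ∀ n, κ (n + 1) ^ 2 = κ n ^ 2 + f (n + 1) * g (n + 1)
  left : ∀ n, κ n * x (n + 1) = κ (n + 1) * (z * x n) + f (n + 1) * y n
  right : ∀ n, κ n * y (n + 1) = κ (n + 1) * y n + g (n + 1) * (z * x n)
  left' : ∀ n, κ n * r (n + 1) = κ (n + 1) * (z * r n) + f (n + 1) * s n
  right' : ∀ n, κ n * s (n + 1) = κ (n + 1) * s n + g (n + 1) * (z * r n)
  casoratian : ∀ n, x n * s n - y n * r n ≠ 0
  rel : ∀ n, f (n + 1) ≠ 0 → -(Ω n + v) * x n + Θ n * x (n + 1) = 0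
  rel' : ∀ n, f (n + 1) ≠ 0 → -(Ω n + v) * r n + Θ n * r (n + 1) = u * x n - 2 * v * r n
  relStar : ∀ n, g (n + 1) ≠ 0 → (Ωs n - v) * y n - Θs n * y (n + 1) = 0
  relStar' : ∀ n, g (n + 1) ≠ 0 → (Ωs n - v) * s n - Θs n * s (n + 1) = u * y n - 2 * v * s n

/-- The recurrence with `y₀` traded for `y₁`: `norm` reduces the coefficient of `z x₀` from `κ₁² - f
g` to `κ₀²`. -/
theorem szego_left_succ {κ₀ κ₁ f g z x₀ x₁ y₀ y₁ : ℂ} (hκ : κ₀ ≠ 0)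
    (norm : κ₁ ^ 2 = κ₀ ^ 2 + f * g) (left : κ₀ * x₁ = κ₁ * (z * x₀) + f * y₀)
    (right : κ₀ * y₁ = κ₁ * y₀ + g * (z * x₀)) : κ₁ * x₁ = κ₀ * (z * x₀) + f * y₁ := by
  refine mul_left_cancel₀ hκ ?_
  linear_combination κ₁ * left - f * right + z * x₀ * norm

theorem szego_right_succ {κ₀ κ₁ f g z x₀ x₁ y₀ y₁ : ℂ} (hκ : κ₀ ≠ 0)
    (norm : κ₁ ^ 2 = κ₀ ^ 2 + f * g) (left : κ₀ * x₁ = κ₁ * (z * x₀) + f * y₀)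
    (right : κ₀ * y₁ = κ₁ * y₀ + g * (z * x₀)) : κ₁ * y₁ = κ₀ * y₀ + g * x₁ := by
  refine mul_left_cancel₀ hκ ?_
  linear_combination κ₁ * right - g * left + y₀ * norm

namespace ResidueSystem

variable {κ f g : ℕ → ℂ} {z u v : ℂ} {x y r s Θ Ω Θs Ωs : ℕ → ℂ}

theorem eq_left (S : ResidueSystem κ f g z u v x y r s Θ Ω Θs Ωs) (n : ℕ) :
    x (n + 1) = κ (n + 1) / κ n * z * x n + f (n + 1) / κ n * y n ∧
    r (n + 1) = κ (n + 1) / κ n * z * r n + f (n + 1) / κ n * s n := by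
  have h := S.κ_ne n
  constructor
  · field_simp
    linear_combination S.left n
  · field_simp
    linear_combination S.left' n

theorem eq_right (S : ResidueSystem κ f g z u v x y r s Θ Ω Θs Ωs) (n : ℕ) :
    y (n + 1) = κ (n + 1) / κ n * y n + g (n + 1) / κ n * z * x n ∧
    s (n + 1) = κ (n + 1) / κ n * s n + g (n + 1) / κ n * z * r n := by
  have h := S.κ_ne n
  constructor
  · field_simp
    linear_combination S.right n
  · field_simp
    linear_combination S.right' n

theorem eq_left_succ (S : ResidueSystem κ f g z u v x y r s Θ Ω Θs Ωs) (n : ℕ) :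
    x (n + 1) = κ n / κ (n + 1) * z * x n + f (n + 1) / κ (n + 1) * y (n + 1) ∧
    r (n + 1) = κ n / κ (n + 1) * z * r n + f (n + 1) / κ (n + 1) * s (n + 1) := by
  have h := S.κ_ne (n + 1)
  constructor
  · field_simp
    linear_combination szego_left_succ (S.κ_ne n) (S.norm n) (S.left n) (S.right n)
  · field_simp
    linear_combination szego_left_succ (S.κ_ne n) (S.norm n) (S.left' n) (S.right' n)

theorem eq_right_succ (S : ResidueSystem κ f g z u v x y r s Θ Ω Θs Ωs) (n : ℕ) :
    y (n + 1) = κ n / κ (n + 1) * y n + g (n + 1) / κ (n + 1) * x (n + 1) ∧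
    s (n + 1) = κ n / κ (n + 1) * s n + g (n + 1) / κ (n + 1) * r (n + 1) := by
  have h := S.κ_ne (n + 1)
  constructor
  · field_simp
    linear_combination szego_right_succ (S.κ_ne n) (S.norm n) (S.left n) (S.right n)
  · field_simp
    linear_combination szego_right_succ (S.κ_ne n) (S.norm n) (S.left' n) (S.right' n)

/-- The three term recurrences of `x` and `r`. -/
theorem three_term (S : ResidueSystem κ f g z u v x y r s Θ Ω Θs Ωs) {n : ℕ}
    (hf : f (n + 1) ≠ 0) :
    x (n + 2) = (κ (n + 2) / κ (n + 1) * z + f (n + 2) / f (n + 1)) * x (n + 1) -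
      κ n * f (n + 2) / (κ (n + 1) * f (n + 1)) * z * x n ∧
    r (n + 2) = (κ (n + 2) / κ (n + 1) * z + f (n + 2) / f (n + 1)) * r (n + 1) -
      κ n * f (n + 2) / (κ (n + 1) * f (n + 1)) * z * r n := by
  have h := S.κ_ne (n + 1)
  obtain ⟨h1, h2⟩ := S.eq_left (n + 1)
  constructor
  · have h3 := szego_left_succ (S.κ_ne n) (S.norm n) (S.left n) (S.right n)
    rw [h1]
    field_simp
    linear_combination -f (n + 2) * h3
  · have h3 := szego_left_succ (S.κ_ne n) (S.norm n) (S.left' n) (S.right' n)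
    rw [h2]
    field_simp
    linear_combination -f (n + 2) * h3

/-- The three term recurrences of `y` and `s`. -/
theorem three_term_star (S : ResidueSystem κ f g z u v x y r s Θ Ω Θs Ωs) {n : ℕ}
    (hg : g (n + 1) ≠ 0) :
    y (n + 2) = (κ (n + 2) / κ (n + 1) + g (n + 2) / g (n + 1) * z) * y (n + 1) -
      κ n * g (n + 2) / (κ (n + 1) * g (n + 1)) * z * y n ∧
    s (n + 2) = (κ (n + 2) / κ (n + 1) + g (n + 2) / g (n + 1) * z) * s (n + 1) -
      κ n * g (n + 2) / (κ (n + 1) * g (n + 1)) * z * s n := by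
  have h := S.κ_ne (n + 1)
  obtain ⟨h1, h2⟩ := S.eq_right (n + 1)
  constructor
  · have h3 := szego_right_succ (S.κ_ne n) (S.norm n) (S.left n) (S.right n)
    rw [h1]
    field_simp
    linear_combination -g (n + 2) * z * h3
  · have h3 := szego_right_succ (S.κ_ne n) (S.norm n) (S.left' n) (S.right' n)
    rw [h2]
    field_simp
    linear_combination -g (n + 2) * z * h3

/-- The basis is `(φ_n, φ_{n+1})`. The second row is the relation at `n + 1`, with `φ_{n+2}` removed
by the three term recurrence. The trace part is kept for `bilinear_shift_left`. -/
theorem trace_and_bilinear_left (S : ResidueSystem κ f g z u v x y r s Θ Ω Θs Ωs) {n : ℕ}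
    (h₁ : f (n + 1) ≠ 0) (h₂ : f (n + 2) ≠ 0) :
    Ω n + Ω (n + 1) = Θ (n + 1) * (κ (n + 2) / κ (n + 1) * z + f (n + 2) / f (n + 1)) ∧
    Ω n ^ 2 = κ n * f (n + 2) / (κ (n + 1) * f (n + 1)) * z * Θ n * Θ (n + 1) + v ^ 2 := by
  obtain ⟨t1, t2⟩ := S.three_term h₁
  have hD : x n * r (n + 1) - x (n + 1) * r n ≠ 0 := by
    have : x n * r (n + 1) - x (n + 1) * r n = f (n + 1) / κ n * (x n * s n - y n * r n) := by
      rw [(S.eq_left n).1, (S.eq_left n).2]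
      ring
    rw [this]
    exact mul_ne_zero (div_ne_zero h₁ (S.κ_ne n)) (S.casoratian n)
  have h3 := S.rel (n + 1) h₂
  have h4 := S.rel' (n + 1) h₂
  rw [t1] at h3
  rw [t2] at h4
  obtain ⟨ht, hb⟩ := trace_and_bilinear_identity (u := u) (v := v)
    (a' := -(κ n * f (n + 2) / (κ (n + 1) * f (n + 1)) * z * Θ (n + 1)))
    (b' := Θ (n + 1) * (κ (n + 2) / κ (n + 1) * z + f (n + 2) / f (n + 1)) - Ω (n + 1) - v)
    (S.rel n h₁) (by linear_combination h3) (S.rel' n h₁) (by linear_combination h4) hD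
  constructor
  · linear_combination -ht
  · linear_combination hb

theorem trace_and_bilinear_right (S : ResidueSystem κ f g z u v x y r s Θ Ω Θs Ωs) {n : ℕ}
    (h₁ : g (n + 1) ≠ 0) (h₂ : g (n + 2) ≠ 0) :
    Ωs n + Ωs (n + 1) = Θs (n + 1) * (κ (n + 2) / κ (n + 1) + g (n + 2) / g (n + 1) * z) ∧
    Ωs n ^ 2 = κ n * g (n + 2) / (κ (n + 1) * g (n + 1)) * z * Θs n * Θs (n + 1) + v ^ 2 := by
  obtain ⟨t1, t2⟩ := S.three_term_star h₁
  have hD : y n * s (n + 1) - y (n + 1) * s n ≠ 0 := by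
    have : y n * s (n + 1) - y (n + 1) * s n =
        -(g (n + 1) / κ n * z * (x n * s n - y n * r n)) := by
      rw [(S.eq_right n).1, (S.eq_right n).2]
      ring
    rw [this]
    exact neg_ne_zero.2 (mul_ne_zero (mul_ne_zero (div_ne_zero h₁ (S.κ_ne n)) S.z_ne)
      (S.casoratian n))
  have h3 := S.relStar (n + 1) h₂
  have h4 := S.relStar' (n + 1) h₂
  rw [t1] at h3
  rw [t2] at h4
  obtain ⟨ht, hb⟩ := trace_and_bilinear_identity (u := u) (v := v) (a := Ωs n - v) (b := -Θs n)
    (a' := κ n * g (n + 2) / (κ (n + 1) * g (n + 1)) * z * Θs (n + 1))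
    (b' := Ωs (n + 1) - v -
      Θs (n + 1) * (κ (n + 2) / κ (n + 1) + g (n + 2) / g (n + 1) * z))
    (by linear_combination S.relStar n h₁) (by linear_combination h3)
    (by linear_combination S.relStar' n h₁) (by linear_combination h4) hD
  constructor
  · linear_combination ht
  · linear_combination hb

/-- The basis is `(φ_n, φ*_n)`. The trace condition says that the two expressions being squared are
equal, so one determinant identity gives both conclusions. -/
theorem bilinear_same (S : ResidueSystem κ f g z u v x y r s Θ Ω Θs Ωs) {n : ℕ}
    (h₁ : f (n + 1) ≠ 0) (h₂ : g (n + 1) ≠ 0) :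
    f (n + 1) * g (n + 1) / κ n ^ 2 * z * Θ n * Θs n + v ^ 2 =
      (Ω n - κ (n + 1) / κ n * z * Θ n) ^ 2 ∧
    f (n + 1) * g (n + 1) / κ n ^ 2 * z * Θ n * Θs n + v ^ 2 =
      (Ωs n - κ (n + 1) / κ n * Θs n) ^ 2 := by
  have h3 := S.rel n h₁
  have h4 := S.rel' n h₁
  have h5 := S.relStar n h₂
  have h6 := S.relStar' n h₂
  rw [(S.eq_left n).1] at h3
  rw [(S.eq_left n).2] at h4
  rw [(S.eq_right n).1] at h5
  rw [(S.eq_right n).2] at h6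
  obtain ⟨ht, hb⟩ := trace_and_bilinear_identity (u := u) (v := v)
    (a := κ (n + 1) / κ n * z * Θ n - Ω n - v) (b := f (n + 1) / κ n * Θ n)
    (a' := -(g (n + 1) / κ n * z * Θs n)) (b' := Ωs n - v - κ (n + 1) / κ n * Θs n)
    (by linear_combination h3) (by linear_combination h5)
    (by linear_combination h4) (by linear_combination h6) (S.casoratian n)
  have hb' : f (n + 1) * g (n + 1) / κ n ^ 2 * z * Θ n * Θs n + v ^ 2 =
      (Ω n - κ (n + 1) / κ n * z * Θ n) ^ 2 := by
    linear_combination -hb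
  refine ⟨hb', hb'.trans ?_⟩
  have ht' : Ωs n - κ (n + 1) / κ n * Θs n = Ω n - κ (n + 1) / κ n * z * Θ n := by
    linear_combination ht
  rw [ht']

/-- The basis is `(φ_{n+1}, φ*_n)`: `φ_{n+2}` is expressed through `φ_{n+1}` and `φ*_{n+1}`, and
then `φ*_{n+1}` through `φ*_n` and `φ_{n+1}`. -/
theorem bilinear_shift_left (S : ResidueSystem κ f g z u v x y r s Θ Ω Θs Ωs) {n : ℕ}
    (h₁ : f (n + 1) ≠ 0) (h₂ : g (n + 1) ≠ 0) (h₃ : f (n + 2) ≠ 0) :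
    (Ω n - κ n ^ 2 / κ (n + 1) ^ 2 * (f (n + 2) / f (n + 1)) * Θ (n + 1)) ^ 2 =
      κ n * f (n + 2) * g (n + 1) / κ (n + 1) ^ 3 * Θ (n + 1) * Θs n + v ^ 2 := by
  have hκ := S.κ_ne (n + 1)
  have ht := (S.trace_and_bilinear_left h₁ h₃).1
  have h4 := S.rel (n + 1) h₃
  have h5 := S.rel' (n + 1) h₃
  have h6 := S.relStar n h₂
  have h7 := S.relStar' n h₂
  rw [(S.eq_left (n + 1)).1, (S.eq_right_succ n).1] at h4
  rw [(S.eq_left (n + 1)).2, (S.eq_right_succ n).2] at h5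
  rw [(S.eq_right_succ n).1] at h6
  rw [(S.eq_right_succ n).2] at h7
  have hD : x (n + 1) * s n - y n * r (n + 1) ≠ 0 := by
    have : x (n + 1) * s n - y n * r (n + 1) =
        κ (n + 1) / κ n * z * (x n * s n - y n * r n) := by
      rw [(S.eq_left n).1, (S.eq_left n).2]
      ring
    rw [this]
    exact mul_ne_zero (mul_ne_zero (div_ne_zero hκ (S.κ_ne n)) S.z_ne) (S.casoratian n)
  obtain ⟨-, hb⟩ := trace_and_bilinear_identity (u := u) (v := v)
    (a := Θ (n + 1) * (κ (n + 2) / κ (n + 1) * z +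
      f (n + 2) / κ (n + 1) * (g (n + 1) / κ (n + 1))) - Ω (n + 1) - v)
    (b := Θ (n + 1) * (f (n + 2) / κ (n + 1) * (κ n / κ (n + 1))))
    (a' := -(Θs n * (g (n + 1) / κ (n + 1)))) (b' := Ωs n - v - Θs n * (κ n / κ (n + 1)))
    (by linear_combination h4) (by linear_combination h6)
    (by linear_combination h5) (by linear_combination h7) hD
  -- The matrix contains `Ω (n + 1)`; the trace identity `ht` exchanges it for `Ω n`, and `norm`
  -- gives the coefficient its stated form.
  have ha : Ω n - κ n ^ 2 / κ (n + 1) ^ 2 * (f (n + 2) / f (n + 1)) * Θ (n + 1) =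
      Θ (n + 1) * (κ (n + 2) / κ (n + 1) * z +
        f (n + 2) / κ (n + 1) * (g (n + 1) / κ (n + 1))) - Ω (n + 1) - v + v := by
    have h8 : f (n + 2) / κ (n + 1) * (g (n + 1) / κ (n + 1)) =
        f (n + 2) / f (n + 1) - κ n ^ 2 / κ (n + 1) ^ 2 * (f (n + 2) / f (n + 1)) := by
      field_simp
      linear_combination -S.norm n
    rw [h8]
    linear_combination ht
  rw [ha, hb]
  field_simp
  ring

/-- The mirror case, in the basis `(φ*_{n+1}, φ_n)`. -/
theorem bilinear_shift_right (S : ResidueSystem κ f g z u v x y r s Θ Ω Θs Ωs) {n : ℕ}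
    (h₁ : f (n + 1) ≠ 0) (h₂ : g (n + 1) ≠ 0) (h₃ : g (n + 2) ≠ 0) :
    (Ωs n - κ n ^ 2 / κ (n + 1) ^ 2 * (g (n + 2) / g (n + 1)) * z * Θs (n + 1)) ^ 2 =
      κ n * g (n + 2) * f (n + 1) / κ (n + 1) ^ 3 * z ^ 2 * Θs (n + 1) * Θ n + v ^ 2 := by
  have hκ := S.κ_ne (n + 1)
  have ht := (S.trace_and_bilinear_right h₂ h₃).1
  have h4 := S.relStar (n + 1) h₃
  have h5 := S.relStar' (n + 1) h₃
  have h6 := S.rel n h₁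
  have h7 := S.rel' n h₁
  rw [(S.eq_right (n + 1)).1, (S.eq_left_succ n).1] at h4
  rw [(S.eq_right (n + 1)).2, (S.eq_left_succ n).2] at h5
  rw [(S.eq_left_succ n).1] at h6
  rw [(S.eq_left_succ n).2] at h7
  have hD : y (n + 1) * r n - x n * s (n + 1) ≠ 0 := by
    have : y (n + 1) * r n - x n * s (n + 1) =
        -(κ (n + 1) / κ n * (x n * s n - y n * r n)) := by
      rw [(S.eq_right n).1, (S.eq_right n).2]
      ring
    rw [this]
    exact neg_ne_zero.2 (mul_ne_zero (div_ne_zero hκ (S.κ_ne n)) (S.casoratian n))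
  obtain ⟨-, hb⟩ := trace_and_bilinear_identity (u := u) (v := v)
    (a := Ωs (n + 1) - v - Θs (n + 1) * (κ (n + 2) / κ (n + 1) +
      g (n + 2) / κ (n + 1) * z * (f (n + 1) / κ (n + 1))))
    (b := -(Θs (n + 1) * (g (n + 2) / κ (n + 1) * z * (κ n / κ (n + 1) * z))))
    (a' := Θ n * (f (n + 1) / κ (n + 1))) (b' := Θ n * (κ n / κ (n + 1) * z) - (Ω n + v))
    (by linear_combination h4) (by linear_combination h6)
    (by linear_combination h5) (by linear_combination h7) hD
  have ha : (Ωs n - κ n ^ 2 / κ (n + 1) ^ 2 * (g (n + 2) / g (n + 1)) * z * Θs (n + 1)) ^ 2 =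
      (Ωs (n + 1) - v - Θs (n + 1) * (κ (n + 2) / κ (n + 1) +
        g (n + 2) / κ (n + 1) * z * (f (n + 1) / κ (n + 1))) + v) ^ 2 := by
    have h8 : g (n + 2) / κ (n + 1) * z * (f (n + 1) / κ (n + 1)) =
        (g (n + 2) / g (n + 1) - κ n ^ 2 / κ (n + 1) ^ 2 * (g (n + 2) / g (n + 1))) * z := by
      field_simp
      linear_combination -z * S.norm n
    -- Here the trace identity gives the bracket with the opposite sign, which the square absorbs.
    rw [h8, ← neg_sq]
    congr 1
    linear_combination -ht
  rw [ha, hb]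
  field_simp
  ring

end ResidueSystem

/-! ### From the weight to the algebraic system at a zero of `W` -/

section

variable {W V U : ℂ[X]} {w : ℂ → ℂ} {φ φb ψ χ : ℕ → ℂ[X]}

/-- Replacing `ε_n` by `ψ_n` removes the restriction to points off the circle. -/
theorem IsSecondKind.isCoeffPair_iff (S : IsSecondKind w φ φb ψ χ)
    (hF : ∀ z : ℂ, ‖z‖ ≠ 1 → DifferentiableAt ℂ (caratheodory w) z ∧
      W.eval z * deriv (caratheodory w) z = 2 * V.eval z * caratheodory w z + U.eval z)
    (n : ℕ) (p : ℂ[X] × ℂ[X]) :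
    IsCoeffPair W V w φ n p ↔
      W * derivative (φ n) = -(p.2 + V) * φ n + p.1 * φ (n + 1) ∧
      W * derivative (ψ n) + U * φ n = (-(p.2 + V) + 2 * V) * ψ n + p.1 * ψ (n + 1) := by
  have key := fun h => assoc_relation_iff (a := -(p.2 + V)) (b := p.1) hF (S.eps_eq n)
    (S.eps_eq (n + 1)) h
  constructor
  · intro h
    have h1 : W * derivative (φ n) = -(p.2 + V) * φ n + p.1 * φ (n + 1) := by
      linear_combination h.poly
    refine ⟨h1, (key h1).1 fun z hz => ?_⟩
    rw [h.assoc z hz]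
    simp only [eval_neg, eval_add]
    ring
  · rintro ⟨h1, h2⟩
    refine ⟨by linear_combination h1, fun z hz => ?_⟩
    rw [(key h1).2 h2 z hz]
    simp only [eval_neg, eval_add]
    ring

theorem IsSecondKind.isCoeffPairStar_iff (S : IsSecondKind w φ φb ψ χ)
    (hF : ∀ z : ℂ, ‖z‖ ≠ 1 → DifferentiableAt ℂ (caratheodory w) z ∧
      W.eval z * deriv (caratheodory w) z = 2 * V.eval z * caratheodory w z + U.eval z)
    (n : ℕ) (p : ℂ[X] × ℂ[X]) :
    IsCoeffPairStar W V w φb n p ↔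
      W * derivative (recip φb n) = (p.2 - V) * recip φb n + -p.1 * recip φb (n + 1) ∧
      W * derivative (χ n) + U * recip φb n =
        (p.2 - V + 2 * V) * χ n + -p.1 * χ (n + 1) := by
  have key := fun h => assoc_relation_iff (a := p.2 - V) (b := -p.1) hF (S.neg_epsStar_eq n)
    (S.neg_epsStar_eq (n + 1)) h
  simp only [deriv.fun_neg] at key
  constructor
  · intro h
    have h1 : W * derivative (recip φb n) =
        (p.2 - V) * recip φb n + -p.1 * recip φb (n + 1) := by
      linear_combination h.poly
    refine ⟨h1, (key h1).1 fun z hz => ?_⟩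
    simp only [eval_neg, eval_sub]
    linear_combination -h.assoc z hz
  · rintro ⟨h1, h2⟩
    refine ⟨by linear_combination h1, fun z hz => ?_⟩
    have h3 := (key h1).2 h2 z hz
    simp only [eval_neg, eval_sub] at h3
    linear_combination -h3

/-- The Taylor coefficients of `ε_n` at `0` are twice the pairings of `φ_n` with `ζ^k`, which vanish
for `k < n`. -/
theorem IsBiorthonormal.exists_eps_eq_pow_mul (hφ : IsBiorthonormal w φ φb)
    (hw : ContinuousOn w (sphere 0 1)) (n : ℕ) : ∃ h : ℂ → ℂ, DifferentiableOn ℂ h (ball 0 1) ∧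
      ∀ z ∈ ball (0 : ℂ) 1, eps w φ n z = z ^ n * h z := by
  obtain ⟨h, hd, he⟩ := exists_weightTransform_expansion hw (φ n) n
  refine ⟨h, hd, fun z hz => ?_⟩
  rw [hφ.eps_eq hw n (norm_ne_one_of_mem_ball hz), he z hz, Finset.sum_eq_zero, mul_zero, zero_add]
  intro k hk
  rw [hφ.weightPairing_left_X_pow hw (Finset.mem_range.1 hk), zero_mul]

/-- The order is one higher than for `ε_n`: the pairings of `φ*_n` with `ζ, …, ζ^n` vanish, and the
constant term is cancelled by `2/κ_n`. -/
theorem IsBiorthonormal.exists_epsStar_eq_pow_mul (hφ : IsBiorthonormal w φ φb)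
    (hw : ContinuousOn w (sphere 0 1)) (n : ℕ) : ∃ h : ℂ → ℂ, DifferentiableOn ℂ h (ball 0 1) ∧
      ∀ z ∈ ball (0 : ℂ) 1, -epsStar w φb n z = z ^ (n + 1) * h z := by
  obtain ⟨h, hd, he⟩ := exists_weightTransform_expansion hw (recip φb n) (n + 1)
  refine ⟨h, hd, fun z hz => ?_⟩
  rw [hφ.epsStar_eq hw n (norm_ne_one_of_mem_ball hz), he z hz,
    hφ.sum_weightPairing_recip hw (by omega) le_rfl]
  ring

theorem IsBiorthonormal.existsUnique_isCoeffPair (hφ : IsBiorthonormal w φ φb)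
    (hw : ContinuousOn w (sphere 0 1)) (S : IsSecondKind w φ φb ψ χ) (hW0 : W.eval 0 = 0)
    (hF : ∀ z : ℂ, ‖z‖ ≠ 1 → DifferentiableAt ℂ (caratheodory w) z ∧
      W.eval z * deriv (caratheodory w) z = 2 * V.eval z * caratheodory w z + U.eval z)
    {n : ℕ} (hn : (φ (n + 1)).eval 0 ≠ 0) : ∃! p, IsCoeffPair W V w φ n p := by
  have hκ := hφ.leadingCoeff_ne_zero n
  obtain ⟨h₁, hd₁, he₁⟩ := hφ.exists_eps_eq_pow_mul hw n
  obtain ⟨h₂, hd₂, he₂⟩ := hφ.exists_eps_eq_pow_mul hw (n + 1)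
  have hD : φ n * ψ (n + 1) - φ (n + 1) * ψ n =
      C (-2 * (φ (n + 1)).eval 0 / (φ n).leadingCoeff) * X ^ n := by
    refine mul_left_cancel₀ (C_ne_zero.2 hκ) ?_
    rw [← mul_assoc, ← C_mul, mul_div_cancel₀ _ hκ, C_mul]
    linear_combination φ n * S.left_succ n - ψ n * hφ.left_succ hw n +
      C ((φ (n + 1)).eval 0) * S.casoratian n
  -- The determinant has order `n`, as does `ε_n`; the surplus factor `z` of `ε_{n+1}` goes into the
  -- second cofactor.
  obtain ⟨⟨a, b⟩, hab, huniq⟩ := existsUnique_coefficients (h₂ := fun z => z * h₂ z) hW0 hF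
    (S.eps_eq n) (S.eps_eq (n + 1)) (div_ne_zero (mul_ne_zero (by norm_num) hn) hκ) hD hd₁
    (differentiableOn_id.mul hd₂) he₁ (fun z hz => by rw [he₂ z hz, pow_succ, mul_assoc])
  refine ⟨(b, -a - V), ?_, fun p hp => ?_⟩
  · simp only [S.isCoeffPair_iff hF]
    simpa using hab
  · have h := huniq (-(p.2 + V), p.1) ((S.isCoeffPair_iff hF n p).1 hp)
    rw [Prod.mk.injEq] at h
    refine Prod.ext h.2 ?_
    simp only
    linear_combination -h.1

theorem IsBiorthonormal.existsUnique_isCoeffPairStar (hφ : IsBiorthonormal w φ φb)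
    (hw : ContinuousOn w (sphere 0 1)) (S : IsSecondKind w φ φb ψ χ) (hW0 : W.eval 0 = 0)
    (hF : ∀ z : ℂ, ‖z‖ ≠ 1 → DifferentiableAt ℂ (caratheodory w) z ∧
      W.eval z * deriv (caratheodory w) z = 2 * V.eval z * caratheodory w z + U.eval z)
    {n : ℕ} (hn : (φb (n + 1)).eval 0 ≠ 0) : ∃! p, IsCoeffPairStar W V w φb n p := by
  have hκ := hφ.leadingCoeff_ne_zero n
  obtain ⟨h₁, hd₁, he₁⟩ := hφ.exists_epsStar_eq_pow_mul hw n
  obtain ⟨h₂, hd₂, he₂⟩ := hφ.exists_epsStar_eq_pow_mul hw (n + 1)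
  -- Order `n + 1`, matching the vanishing of `ε*_n` at `0`.
  have hD : recip φb n * χ (n + 1) - recip φb (n + 1) * χ n =
      C (2 * (φb (n + 1)).eval 0 / (φ n).leadingCoeff) * X ^ (n + 1) := by
    refine mul_left_cancel₀ (C_ne_zero.2 hκ) ?_
    rw [← mul_assoc, ← C_mul, mul_div_cancel₀ _ hκ, C_mul]
    have h2 : C (-2 : ℂ) = -C 2 := C_neg
    have h3 := S.casoratian n
    rw [h2] at h3
    linear_combination recip φb n * S.right_succ n - χ n * hφ.recip_succ hw n -
      (C ((φb (n + 1)).eval 0) * X) * h3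
  obtain ⟨⟨a, b⟩, hab, huniq⟩ := existsUnique_coefficients (h₂ := fun z => z * h₂ z) hW0 hF
    (S.neg_epsStar_eq n) (S.neg_epsStar_eq (n + 1))
    (div_ne_zero (mul_ne_zero (by norm_num) hn) hκ) hD hd₁
    (differentiableOn_id.mul hd₂) he₁ (fun z hz => by rw [he₂ z hz, pow_succ, mul_assoc])
  refine ⟨(-b, a + V), ?_, fun p hp => ?_⟩
  · simp only [S.isCoeffPairStar_iff hF]
    simpa using hab
  · have h := huniq (p.2 - V, -p.1) ((S.isCoeffPairStar_iff hF n p).1 hp)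
    rw [Prod.mk.injEq] at h
    refine Prod.ext ?_ ?_
    · simp only
      linear_combination -h.2
    · simp only
      linear_combination h.1

theorem isCoeffPair_iff_eq_coeffPair {n : ℕ} (h : ∃! p, IsCoeffPair W V w φ n p)
    (p : ℂ[X] × ℂ[X]) : IsCoeffPair W V w φ n p ↔ p = coeffPair W V w φ n := by
  have hc : IsCoeffPair W V w φ n (coeffPair W V w φ n) := by
    rw [coeffPair, dif_pos h.exists]
    exact h.exists.choose_spec
  exact ⟨fun hp => h.unique hp hc, fun hp => hp ▸ hc⟩

theorem isCoeffPairStar_iff_eq_coeffPairStar {n : ℕ} (h : ∃! p, IsCoeffPairStar W V w φb n p)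
    (p : ℂ[X] × ℂ[X]) : IsCoeffPairStar W V w φb n p ↔ p = coeffPairStar W V w φb n := by
  have hc : IsCoeffPairStar W V w φb n (coeffPairStar W V w φb n) := by
    rw [coeffPairStar, dif_pos h.exists]
    exact h.exists.choose_spec
  exact ⟨fun hp => h.unique hp hc, fun hp => hp ▸ hc⟩

/-- Evaluation at a zero of `W` turns the differential relations into linear equations; `z ≠ 0`
keeps the Casoratian `-2 z^n` from vanishing. -/
theorem IsBiorthonormal.residueSystem (hφ : IsBiorthonormal w φ φb)
    (hw : ContinuousOn w (sphere 0 1)) (S : IsSecondKind w φ φb ψ χ) (hW0 : W.eval 0 = 0)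
    (hF : ∀ z : ℂ, ‖z‖ ≠ 1 → DifferentiableAt ℂ (caratheodory w) z ∧
      W.eval z * deriv (caratheodory w) z = 2 * V.eval z * caratheodory w z + U.eval z)
    {z : ℂ} (hz : W.IsRoot z) (hz0 : z ≠ 0) :
    ResidueSystem (fun n => (φ n).leadingCoeff) (fun n => (φ n).eval 0) (fun n => (φb n).eval 0)
      z (U.eval z) (V.eval z) (fun n => (φ n).eval z) (fun n => (recip φb n).eval z)
      (fun n => (ψ n).eval z) (fun n => (χ n).eval z)
      (fun n => (coeffPair W V w φ n).1.eval z) (fun n => (coeffPair W V w φ n).2.eval z)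
      (fun n => (coeffPairStar W V w φb n).1.eval z)
      (fun n => (coeffPairStar W V w φb n).2.eval z) := by
  have hWz : W.eval z = 0 := hz
  have hpair := fun n hn => (S.isCoeffPair_iff hF n _).1 ((isCoeffPair_iff_eq_coeffPair
    (hφ.existsUnique_isCoeffPair hw S hW0 hF (n := n) hn) _).2 rfl)
  have hpairs := fun n hn => (S.isCoeffPairStar_iff hF n _).1 ((isCoeffPairStar_iff_eq_coeffPairStar
    (hφ.existsUnique_isCoeffPairStar hw S hW0 hF (n := n) hn) _).2 rfl)
  refine ⟨hφ.leadingCoeff_ne_zero, hz0, hφ.leadingCoeff_succ_sq hw, fun n => ?_, fun n => ?_,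
    fun n => ?_, fun n => ?_, fun n => ?_, fun n hn => ?_, fun n hn => ?_, fun n hn => ?_,
    fun n hn => ?_⟩
  · simpa using congrArg (eval z) (hφ.left_succ hw n)
  · simpa using congrArg (eval z) (hφ.recip_succ hw n)
  · simpa using congrArg (eval z) (S.left_succ n)
  · simpa using congrArg (eval z) (S.right_succ n)
  · have h := congrArg (eval z) (S.casoratian n)
    simp only [eval_sub, eval_mul, eval_C, eval_pow, eval_X] at h
    rw [h]
    exact mul_ne_zero (by norm_num) (pow_ne_zero n hz0)
  · have h := congrArg (eval z) (hpair n hn).1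
    simp only [eval_add, eval_mul, eval_neg, hWz, zero_mul] at h
    exact h.symm
  · have h := congrArg (eval z) (hpair n hn).2
    simp only [eval_add, eval_mul, eval_neg, eval_ofNat, hWz, zero_mul] at h
    linear_combination -h
  · have h := congrArg (eval z) (hpairs n hn).1
    simp only [eval_add, eval_sub, eval_mul, eval_neg, hWz, zero_mul] at h
    linear_combination -h
  · have h := congrArg (eval z) (hpairs n hn).2
    simp only [eval_add, eval_sub, eval_mul, eval_neg, eval_ofNat, hWz, zero_mul] at h
    linear_combination -h

end

end SemiclassicalOPUC

open SemiclassicalOPUC in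
theorem mainTheorem7 (W V : ℂ[X]) (w : ℂ → ℂ) (φ φb : ℕ → ℂ[X])
    (hw : IsRegularSemiclassicalWeight W V w) (hW0 : W.eval 0 = 0)
    (hφ : IsBiorthonormal w φ φb) :
    -- the coefficient functions are well defined polynomials
    (∀ n : ℕ, (φ (n + 1)).eval 0 ≠ 0 →
      ∀ p : ℂ[X] × ℂ[X], IsCoeffPair W V w φ n p ↔ p = coeffPair W V w φ n) ∧
    (∀ n : ℕ, (φb (n + 1)).eval 0 ≠ 0 →
      ∀ p : ℂ[X] × ℂ[X], IsCoeffPairStar W V w φb n p ↔ p = coeffPairStar W V w φb n) ∧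
    -- the bilinear identities at the nonzero zeros of `W`
    (let κ : ℕ → ℂ := fun n => (φ n).leadingCoeff
     let f : ℕ → ℂ := fun n => (φ n).eval 0
     let g : ℕ → ℂ := fun n => (φb n).eval 0
     ∀ z : ℂ, W.IsRoot z → z ≠ 0 →
      let v : ℂ := V.eval z
      let Θ : ℕ → ℂ := fun n => (coeffPair W V w φ n).1.eval z
      let Ω : ℕ → ℂ := fun n => (coeffPair W V w φ n).2.eval z
      let Θs : ℕ → ℂ := fun n => (coeffPairStar W V w φb n).1.eval z
      let Ωs : ℕ → ℂ := fun n => (coeffPairStar W V w φb n).2.eval z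
      (∀ n : ℕ, f (n + 1) ≠ 0 → f (n + 2) ≠ 0 →
        Ω n ^ 2 = κ n * f (n + 2) / (κ (n + 1) * f (n + 1)) * z * Θ n * Θ (n + 1) + v ^ 2) ∧
      (∀ n : ℕ, g (n + 1) ≠ 0 → g (n + 2) ≠ 0 →
        Ωs n ^ 2 = κ n * g (n + 2) / (κ (n + 1) * g (n + 1)) * z * Θs n * Θs (n + 1) + v ^ 2) ∧
      (∀ n : ℕ, 1 ≤ n → f n ≠ 0 → g n ≠ 0 → f (n + 1) ≠ 0 →
        (Ω (n - 1) - κ (n - 1) ^ 2 / κ n ^ 2 * (f (n + 1) / f n) * Θ n) ^ 2 =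
          κ (n - 1) * f (n + 1) * g n / κ n ^ 3 * Θ n * Θs (n - 1) + v ^ 2) ∧
      (∀ n : ℕ, 1 ≤ n → f n ≠ 0 → g n ≠ 0 → g (n + 1) ≠ 0 →
        (Ωs (n - 1) - κ (n - 1) ^ 2 / κ n ^ 2 * (g (n + 1) / g n) * z * Θs n) ^ 2 =
          κ (n - 1) * g (n + 1) * f n / κ n ^ 3 * z ^ 2 * Θs n * Θ (n - 1) + v ^ 2) ∧
      (∀ n : ℕ, f (n + 1) ≠ 0 → g (n + 1) ≠ 0 →
        f (n + 1) * g (n + 1) / κ n ^ 2 * z * Θ n * Θs n + v ^ 2 =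
          (Ω n - κ (n + 1) / κ n * z * Θ n) ^ 2) ∧
      (∀ n : ℕ, f (n + 1) ≠ 0 → g (n + 1) ≠ 0 →
        f (n + 1) * g (n + 1) / κ n ^ 2 * z * Θ n * Θs n + v ^ 2 =
          (Ωs n - κ (n + 1) / κ n * Θs n) ^ 2)) := by
  obtain ⟨U, hF⟩ := hw.exists_caratheodory_ode
  obtain ⟨ψ, χ, S⟩ := hφ.exists_isSecondKind hw.continuousOn
  refine ⟨fun n hn => isCoeffPair_iff_eq_coeffPair
    (hφ.existsUnique_isCoeffPair hw.continuousOn S hW0 hF hn),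
    fun n hn => isCoeffPairStar_iff_eq_coeffPairStar
    (hφ.existsUnique_isCoeffPairStar hw.continuousOn S hW0 hF hn), ?_⟩
  intro κ f g z hz hz0 v Θ Ω Θs Ωs
  have R := hφ.residueSystem hw.continuousOn S hW0 hF hz hz0
  refine ⟨fun n h₁ h₂ => (R.trace_and_bilinear_left h₁ h₂).2,
    fun n h₁ h₂ => (R.trace_and_bilinear_right h₁ h₂).2, fun n hn h₁ h₂ h₃ => ?_,
    fun n hn h₁ h₂ h₃ => ?_, fun n h₁ h₂ => (R.bilinear_same h₁ h₂).1,
    fun n h₁ h₂ => (R.bilinear_same h₁ h₂).2⟩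
  · obtain ⟨n, rfl⟩ := Nat.exists_eq_add_of_le' hn
    exact R.bilinear_shift_left h₁ h₂ h₃
  · obtain ⟨n, rfl⟩ := Nat.exists_eq_add_of_le' hn
    exact R.bilinear_shift_right h₁ h₂ h₃
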